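/- **Setting.** Let $d\ge 1$, let $\Sigma\in\mathbb R^{d\times d}$ be symmetric positive definite, $s>0$ and $\theta^*\in\mathbb R^d$. Consider the linear regression task with parameter set $\Theta=\mathbb R^d$, squared loss $\ell_\theta(x,y)=(\langle x,\theta\rangle-y)^2$ on $\mathcal Z=\mathbb R^d\times\mathbb R$, and data distribution $\mathcal D$ equal to the law of $(x,\langle x,\theta^*\rangle+\eta)$ with $x\sim\mathcal N(0,\Sigma)$ and $\eta\sim\mathcal N(0,s^2)$ independent. **Notation.** For $Z\in\mathcal Z^n$ write $L_\theta(Z)=\frac1n\sum_{j=1}^n\ell_\theta(z_j)$, $L(Z)=\min_\theta L_\theta(Z)$, $L^{(w)}(Z)=\min_{\theta:\,\theta_1=w}L_\theta(Z)$, $\theta(Z)\in\operatorname{argmin}_\theta L_\theta(Z)$ and $\theta(\mathcal D)\in\operatorname{argmin}_\theta\mathbb E_{z\sim\mathcal D}[\ell_\theta(z)]$. Let $Z_{-i}$ be $Z$ with its $i$-th example deleted but with the normalization kept: $L_\theta(Z_{-i})=\frac1n\sum_{j\ne i}\ell_\theta(z_j)$ and $L(Z_{-i})=\min_\theta L_\theta(Z_{-i})$.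 **Constants.** Put $$N=M=4d,\quad K=144\max\{1,s^2\},\quad \lambda=2s^2,\quad \mu=\frac1{(\Sigma^{-1})_{11}},\quad \sigma=2s .$$ **Claim.** The constants $M,K,\lambda,\mu,\sigma$ are positive, all the minima above exist (also with $\bot$ in place of some of the examples, where $\ell_\theta(\bot)=0$), and the following hold for every $\beta>0$, whichever minimizers $\theta(Z)$ and $\theta(\mathcal D)$ are chosen: 1. For all $\alpha\in(0,1)$ and all integers $n\ge N+\frac{K\log(1/\beta)}{\alpha^2}$, $$\Pr_{Z\sim\mathcal D^n}\bigl[|\theta(Z)_1-\theta(\mathcal D)_1|\ge\alpha\mu^{-1/2}\bigr]\le\beta .$$ 2. For all integers $n\ge M+K\log(1/\beta)$, $$\Pr_{Z\sim\mathcal D^n}\Bigl[\forall w\in\mathbb R:\ \tfrac{\mu}{2}(w-\theta(Z)_1)^2\le L^{(w)}(Z)-L(Z)\le 2\mu(w-\theta(Z)_1)^2\Bigr]\ge 1-\beta .$$ 3. For all integers $n\ge M+K\log(1/\beta)$ and all $i\in\{1,\dots,n\}$, $$\Pr_{Z\sim\mathcal D^n}\Bigl[|L(Z)-L(Z_{-i})|\ge\frac{\lambda\log(2/\beta)}{n}\Bigr]\le\beta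 .$$ 4. For all integers $n\ge1$, $$\Pr_{Z\sim\mathcal D^n}\Bigl[L(Z)\ge\sigma^2\Bigl(1+\frac{\log(1/\beta)}{n}\Bigr)\Bigr]\le\beta .$$ -/

import Mathlib

open MeasureTheory ProbabilityTheory

noncomputable section

/-- A learning task `(Θ, ℓ, 𝒟)`: a parameter set `Θ ⊆ ℝ^d`, a family of nonnegative measurable losses
on the data space `𝒵`, and a data-generating distribution `𝒟` on `𝒵`. -/
structure LearningTask (d : ℕ) (𝒵 : Type*) [MeasurableSpace 𝒵] where
  params : Set (EuclideanSpace ℝ (Fin d))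
  loss : EuclideanSpace ℝ (Fin d) → 𝒵 → ℝ
  loss_nonneg : ∀ θ z, 0 ≤ loss θ z
  measurable_loss : ∀ θ, Measurable (loss θ)
  dist : Measure 𝒵
  isProbabilityMeasure_dist : IsProbabilityMeasure dist

namespace LearningTask

variable {d : ℕ} {𝒵 : Type*} [MeasurableSpace 𝒵] (T : LearningTask d 𝒵)

/-- The law `𝒟^n` of a dataset of `n` i.i.d. samples. -/
def sampleLaw (n : ℕ) : Measure (Fin n → 𝒵) := Measure.pi fun _ => T.dist

/-- The loss on `𝒵 ∪ {⊥}`, with `ℓ_θ(⊥) = 0`; the symbol `⊥` (an absent example) is `none`. -/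
def lossBot (θ : EuclideanSpace ℝ (Fin d)) : Option 𝒵 → ℝ
  | none => 0
  | some z => T.loss θ z

/-- A dataset without absent examples, as a dataset over `𝒵 ∪ {⊥}`. -/
def full {n : ℕ} (Z : Fin n → 𝒵) : Fin n → Option 𝒵 := fun j => some (Z j)

/-- The dataset `Z_{-i}`: the `i`-th example is replaced by `⊥`, the length stays `n`. -/
def leaveOut {n : ℕ} (Z : Fin n → 𝒵) (i : Fin n) : Fin n → Option 𝒵 :=
  Function.update (full Z) i none

/-- The empirical loss `L_θ(S) = (1/n) ∑_j ℓ_θ(S_j)`. -/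
def empLoss {n : ℕ} (θ : EuclideanSpace ℝ (Fin d)) (S : Fin n → Option 𝒵) : ℝ :=
  (1 / (n : ℝ)) * ∑ j, T.lossBot θ (S j)

/-- The population loss `L_θ(𝒟) = 𝔼_{z ∼ 𝒟}[ℓ_θ(z)] ∈ [0, ∞]`. -/
def popLoss (θ : EuclideanSpace ℝ (Fin d)) : ENNReal :=
  ∫⁻ z, ENNReal.ofReal (T.loss θ z) ∂T.dist

/-- `θ` is a minimizer `θ(𝒟)` of the population loss over `Θ`. -/
def IsPopMinimizer (θ : EuclideanSpace ℝ (Fin d)) : Prop :=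
  θ ∈ T.params ∧ ∀ θ' ∈ T.params, T.popLoss θ ≤ T.popLoss θ'

/-- `θ` is a minimizer `θ(S)` of the empirical loss over `Θ`. -/
def IsEmpMinimizer {n : ℕ} (S : Fin n → Option 𝒵) (θ : EuclideanSpace ℝ (Fin d)) : Prop :=
  θ ∈ T.params ∧ ∀ θ' ∈ T.params, T.empLoss θ S ≤ T.empLoss θ' S

/-- The smallest empirical loss `L(S)` over `Θ`. -/
def minLoss {n : ℕ} (S : Fin n → Option 𝒵) : ℝ :=
  sInf {v | ∃ θ ∈ T.params, v = T.empLoss θ S}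

/-- The smallest empirical loss `L^{(w)}(S)` over the parameters in `Θ` with first coordinate `w`. -/
def minLossAt [NeZero d] {n : ℕ} (w : ℝ) (S : Fin n → Option 𝒵) : ℝ :=
  sInf {v | ∃ θ ∈ T.params, θ 0 = w ∧ v = T.empLoss θ S}

/-- Identifiability, concentration and stability of a learning task, with constants
`N`, `M`, `K`, `lam`, `mu`, `sigma`, where the accuracy parameter `α` ranges over `A`.
The first three lines of conditions after positivity say that the minimizers and minima that the
remaining four conditions speak about exist. These four conditions are required for every choice of
minimizers, so that no rule for breaking ties is needed. -/
structure IdentifiableOn [NeZero d] (A : Set ℝ) (N : ℝ → ℝ) (M K lam mu sigma : ℝ) : Prop where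
  pos : 0 < M ∧ 0 < K ∧ 0 < lam ∧ 0 < mu ∧ 0 < sigma
  exists_popMinimizer : ∃ θ, T.IsPopMinimizer θ
  exists_empMinimizer : ∀ (n : ℕ) (S : Fin n → Option 𝒵), ∃ θ, T.IsEmpMinimizer S θ
  exists_minLossAt : ∀ (n : ℕ) (S : Fin n → Option 𝒵) (w : ℝ),
    ∃ θ ∈ T.params, θ 0 = w ∧ ∀ θ' ∈ T.params, θ' 0 = w → T.empLoss θ S ≤ T.empLoss θ' S
  /-- Concentration of the first coordinate of the empirical minimizer. -/
  param_concentration : ∀ α ∈ A, ∀ β : ℝ, 0 < β → ∀ n : ℕ,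
    N α + K * Real.log (1 / β) / α ^ 2 ≤ n →
    ∀ θD, T.IsPopMinimizer θD →
      T.sampleLaw n {Z | ∃ θ, T.IsEmpMinimizer (full Z) θ ∧
        α * mu ^ (-(1 / 2) : ℝ) ≤ |θ 0 - θD 0|} ≤ ENNReal.ofReal β
  /-- Typical smoothness and strong convexity in the first coordinate. -/
  smooth_strongConvex : ∀ β : ℝ, 0 < β → ∀ n : ℕ, M + K * Real.log (1 / β) ≤ n →
    ENNReal.ofReal (1 - β) ≤
      T.sampleLaw n {Z | ∀ θ, T.IsEmpMinimizer (full Z) θ → ∀ w : ℝ,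
        mu * (w - θ 0) ^ 2 / 2 ≤ T.minLossAt w (full Z) - T.minLoss (full Z) ∧
        T.minLossAt w (full Z) - T.minLoss (full Z) ≤ 2 * mu * (w - θ 0) ^ 2}
  /-- Leave-one-out stability of the minimum loss. -/
  leave_one_out : ∀ β : ℝ, 0 < β → ∀ n : ℕ, M + K * Real.log (1 / β) ≤ n → ∀ i : Fin n,
    T.sampleLaw n {Z | lam * Real.log (2 / β) / n ≤
      |T.minLoss (full Z) - T.minLoss (leaveOut Z i)|} ≤ ENNReal.ofReal β
  /-- Upper tail of the minimum loss. -/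
  tail_bound : ∀ β : ℝ, 0 < β → ∀ n : ℕ, 0 < n →
    T.sampleLaw n {Z | sigma ^ 2 * (1 + Real.log (1 / β) / n) ≤ T.minLoss (full Z)} ≤
      ENNReal.ofReal β

end LearningTask

/-- The law of `(x, ⟨x, θ⟩ + η)`, for independent `x ∼ 𝒩(0, Sig)` and `η ∼ 𝒩(0, s²)`. -/
def regressionLaw {d : ℕ} (Sig : Matrix (Fin d) (Fin d) ℝ) (s : ℝ)
    (θ : EuclideanSpace ℝ (Fin d)) : Measure (EuclideanSpace ℝ (Fin d) × ℝ) :=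
  ((multivariateGaussian 0 Sig).prod (gaussianReal 0 (Real.toNNReal (s ^ 2)))).map
    fun p => (p.1, inner ℝ p.1 θ + p.2)

/-- The random-design linear regression task: `Θ = ℝ^d`, squared loss
`ℓ_θ(x, y) = (⟨x, θ⟩ - y)²`, and data law `regressionLaw`. -/
def regressionTask {d : ℕ} (Sig : Matrix (Fin d) (Fin d) ℝ) (s : ℝ)
    (θstar : EuclideanSpace ℝ (Fin d)) : LearningTask d (EuclideanSpace ℝ (Fin d) × ℝ) where
  params := Set.univ
  loss θ z := (inner ℝ z.1 θ - z.2) ^ 2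
  loss_nonneg _ _ := sq_nonneg _
  measurable_loss _ := by fun_prop
  dist := regressionLaw Sig s θstar
  isProbabilityMeasure_dist := Measure.isProbabilityMeasure_map (by fun_prop)

end

/-! ### One-dimensional Gaussian measures: Laplace transform, tails, fourth moment. -/

open scoped NNReal ENNReal

/-! Let X be the design matrix, W the span of its columns other than the first, q the projection of
the first column onto Wᗮ (`firstResidual`), and η the noise vector. Every minimum loss is a squared
norm of a projection (`isLeast_norm_sub_sq`). In particular L^(w)(Z) is quadratic in w with leading
coefficient ‖q‖²/n, so for every minimizer θ(Z) one has L^(w)(Z) - L(Z) = ‖q‖² (w - θ(Z)₁)² / n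
exactly.

Claim 2 therefore follows from nμ/2 < ‖q‖² < 2nμ. From above, ‖q‖ ≤ ‖Xc‖ whenever c₁ = 1, and for c
= `residualDirection` the entries of Xc are i.i.d. 𝒩(0, μ). From below, write x = z + r e₁ with r ∼
𝒩(0, μ) independent of z. The space W depends on the z's alone, so given them q is the projection of
a shifted Gaussian vector onto a fixed space of dimension at least n + 1 - d. Hence 𝔼 exp(-t‖q‖²) ≤
(1 + 2tμ)^(-(n+1-d)/2), whatever the shift. Chernoff bounds then suffice, except for a few small n
with d = 1, which Chebyshev's inequality covers.

For claim 1, ‖q‖² (θ(Z)₁ - θ*₁)² = n (L^(θ*₁)(Z) - L(Z)) = ⟨f, η⟩², where f depends on X only and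
‖f‖ ≤ 1. Given X, a deviation τ has probability at most exp(-τ²‖q‖²/(2s²)), and averaging over X is
the same Laplace transform again.

For claim 3, deleting example i amounts to adding the column e_i to the design, so L(Z) - L(Z_{-i})
= ⟨f, η⟩²/n for another such f. For claim 4, L(Z) ≤ L_{θ*}(Z) = ‖η‖²/n, a chi-square tail. Neither
needs n to be large compared with d. -/

theorem exp_neg_mul_sq_mul_gaussianPDFReal_le {v : ℝ≥0} (hv : v ≠ 0) {c a : ℝ}
    (hc : 0 < 1 + 2 * c * v) (hca : 0 ≤ c * a ^ 2) (x : ℝ) :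
    gaussianPDFReal 0 v x * Real.exp (-(c * (a + x) ^ 2)) ≤
      (Real.sqrt (1 + 2 * c * v))⁻¹ *
        gaussianPDFReal (-(2 * c * v * a) / (1 + 2 * c * v))
          (v / Real.toNNReal (1 + 2 * c * v)) x := by
  have hv' : (0 : ℝ) < v := by positivity
  set w := 1 + 2 * c * (v : ℝ) with hw
  have hexp : -(x - 0) ^ 2 / (2 * (v : ℝ)) + -(c * (a + x) ^ 2) ≤
      -(x - -(2 * c * v * a) / w) ^ 2 / (2 * (v / w)) := by
    -- Completing the square leaves exactly this surplus, which is discarded to make the bound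
    -- independent of the shift `a`.
    have : -(x - -(2 * c * v * a) / w) ^ 2 / (2 * (v / w)) -
        (-(x - 0) ^ 2 / (2 * (v : ℝ)) + -(c * (a + x) ^ 2)) = c * a ^ 2 / w := by
      have hw0 : w ≠ 0 := hc.ne'
      field_simp
      rw [hw]
      ring
    have : 0 ≤ c * a ^ 2 / w := by positivity
    linarith
  have hcast : ((v / Real.toNNReal w : ℝ≥0) : ℝ) = v / w := by
    rw [NNReal.coe_div, Real.coe_toNNReal _ hc.le]
  rw [gaussianPDFReal_def, gaussianPDFReal_def, hcast]
  simp only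
  rw [mul_assoc, ← Real.exp_add, ← mul_assoc]
  have hsq : (Real.sqrt w)⁻¹ * (Real.sqrt (2 * Real.pi * (v / w)))⁻¹ =
      (Real.sqrt (2 * Real.pi * v))⁻¹ := by
    rw [← mul_inv, ← Real.sqrt_mul hc.le]
    congr 2
    field_simp
  rw [hsq]
  gcongr

/-- The condition `0 ≤ c * a ^ 2` covers both uses: `c ≥ 0` with any shift (lower tails), and `c <
0` with `a = 0` (upper tails). -/
theorem lintegral_exp_neg_mul_sq_gaussianReal_le {v : ℝ≥0} (hv : v ≠ 0) {c a : ℝ}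
    (hc : 0 < 1 + 2 * c * v) (hca : 0 ≤ c * a ^ 2) :
    ∫⁻ x, ENNReal.ofReal (Real.exp (-(c * (a + x) ^ 2))) ∂gaussianReal 0 v ≤
      ENNReal.ofReal (Real.sqrt (1 + 2 * c * v))⁻¹ := by
  rw [gaussianReal_of_var_ne_zero _ hv,
    lintegral_withDensity_eq_lintegral_mul _ (measurable_gaussianPDF _ _) (by fun_prop)]
  have hv2 : v / Real.toNNReal (1 + 2 * c * v) ≠ 0 := by
    simp [hv, hc]
  calc _ ≤ ∫⁻ x, ENNReal.ofReal (Real.sqrt (1 + 2 * c * v))⁻¹ *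
        gaussianPDF (-(2 * c * v * a) / (1 + 2 * c * v))
          (v / Real.toNNReal (1 + 2 * c * v)) x := by
        refine lintegral_mono fun x => ?_
        simp only [Pi.mul_apply, gaussianPDF_def]
        rw [← ENNReal.ofReal_mul (gaussianPDFReal_nonneg _ _ _),
          ← ENNReal.ofReal_mul (by positivity)]
        exact ENNReal.ofReal_le_ofReal (exp_neg_mul_sq_mul_gaussianPDFReal_le hv hc hca x)
    _ = _ := by
        rw [lintegral_const_mul _ (measurable_gaussianPDF _ _),
          lintegral_gaussianPDF_eq_one _ hv2, mul_one]

/-- Since (x + y)² ≥ x² + y² for x, y ≥ 0, the shifted density is dominated pointwise on the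
half-line. -/
theorem gaussianReal_neg_Ici_le {v : ℝ≥0} (hv : v ≠ 0) {y : ℝ} (hy : 0 ≤ y) :
    gaussianReal (-y) v (Set.Ici 0) ≤
      ENNReal.ofReal (Real.exp (-(y ^ 2 / (2 * v)))) * gaussianReal 0 v (Set.Ici 0) := by
  rw [gaussianReal_apply _ hv, gaussianReal_apply _ hv,
    ← lintegral_const_mul _ (measurable_gaussianPDF _ _)]
  refine setLIntegral_mono' measurableSet_Ici fun x hx => ?_
  have hx : 0 ≤ x := hx
  rw [gaussianPDF_def, gaussianPDF_def, ← ENNReal.ofReal_mul (by positivity)]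
  refine ENNReal.ofReal_le_ofReal ?_
  rw [gaussianPDFReal_def, gaussianPDFReal_def]
  simp only
  rw [mul_left_comm, ← Real.exp_add]
  gcongr
  rw [neg_div, neg_div, ← neg_add, neg_le_neg_iff, ← add_div]
  gcongr
  nlinarith [mul_nonneg hx hy]

theorem gaussianReal_zero_neg_Iic {v : ℝ≥0} (y : ℝ) :
    gaussianReal 0 v (Set.Iic (-y)) = gaussianReal 0 v (Set.Ici y) := by
  conv_lhs => rw [← neg_zero (G := ℝ), ← gaussianReal_map_neg,
    Measure.map_apply measurable_neg measurableSet_Iic]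
  congr 1
  ext x
  simp

theorem gaussianReal_zero_Ici_zero_le {v : ℝ≥0} (hv : v ≠ 0) :
    2 * gaussianReal 0 v (Set.Ici 0) ≤ 1 := by
  have := nullSingletonClass_gaussianReal (μ := 0) hv
  have h1 : gaussianReal 0 v (Set.Ici 0) = gaussianReal 0 v (Set.Ioi 0) :=
    (measure_congr Ioi_ae_eq_Ici).symm
  have h2 : gaussianReal 0 v (Set.Iic 0) = gaussianReal 0 v (Set.Ici 0) := by
    simpa using gaussianReal_zero_neg_Iic (v := v) 0
  rw [two_mul]
  nth_rw 1 [← h2]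
  rw [h1, ← measure_union (by simp) measurableSet_Ioi]
  exact prob_le_one

/-- The sharp sub-Gaussian tail bound, without a factor `2`. -/
theorem gaussianReal_le_sq_le (v : ℝ≥0) {t : ℝ} (ht : 0 ≤ t) :
    gaussianReal 0 v {x | t ≤ x ^ 2} ≤ ENNReal.ofReal (Real.exp (-(t / (2 * v)))) := by
  rcases eq_or_ne v 0 with rfl | hv
  -- Here `t / (2 * v)` is a division by zero, so the claimed bound is 1.
  · simpa using (prob_le_one : gaussianReal 0 0 {x : ℝ | t ≤ x ^ 2} ≤ 1)
  set y := Real.sqrt t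
  have hy : 0 ≤ y := Real.sqrt_nonneg t
  have hyt : y ^ 2 = t := Real.sq_sqrt ht
  have hset : {x : ℝ | t ≤ x ^ 2} ⊆ Set.Iic (-y) ∪ Set.Ici y := by
    intro x hx
    have hx : y ^ 2 ≤ x ^ 2 := by simpa [hyt] using hx
    have := sq_le_sq.1 hx
    rw [abs_of_nonneg hy] at this
    rcases le_abs.1 this with h | h
    · exact Or.inr h
    · exact Or.inl (by simp; linarith)
  have hshift : gaussianReal 0 v (Set.Ici y) = gaussianReal (-y) v (Set.Ici 0) := by
    rw [show -y = 0 - y by ring, ← gaussianReal_map_sub_const,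
      Measure.map_apply (by fun_prop) measurableSet_Ici]
    congr 1
    ext x
    simp
  -- The factor 2 from the two tails is absorbed by the mass at most 1/2 of the half-line.
  calc _ ≤ _ := (measure_mono hset).trans (measure_union_le _ _)
    _ = 2 * gaussianReal (-y) v (Set.Ici 0) := by
      rw [gaussianReal_zero_neg_Iic, hshift, two_mul]
    _ ≤ 2 * (ENNReal.ofReal (Real.exp (-(y ^ 2 / (2 * v)))) * gaussianReal 0 v (Set.Ici 0)) := by
      gcongr
      exact gaussianReal_neg_Ici_le hv hy
    _ ≤ ENNReal.ofReal (Real.exp (-(t / (2 * v)))) * 1 := by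
      rw [mul_left_comm, hyt]
      gcongr
      exact gaussianReal_zero_Ici_zero_le hv
    _ = _ := mul_one _

/-- The fourth derivative at 0 of the moment generating function exp(vt²/2); each derivative is a
polynomial times this exponential. -/
theorem integral_pow_four_gaussianReal (v : ℝ≥0) :
    ∫ x, x ^ 4 ∂gaussianReal 0 v = 3 * (v : ℝ) ^ 2 := by
  have h0 : ∫ x, x ^ 4 ∂gaussianReal 0 v =
      iteratedDeriv 4 (mgf (fun x => x) (gaussianReal 0 v)) 0 := by
    rw [iteratedDeriv_mgf_zero] <;> simp
  have hE : ∀ t : ℝ, HasDerivAt (fun t : ℝ => Real.exp (v * t ^ 2 / 2))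
      (v * t * Real.exp (v * t ^ 2 / 2)) t := by
    intro t
    have h : HasDerivAt (fun t : ℝ => (v : ℝ) * t ^ 2 / 2) (v * t) t := by
      have := ((hasDerivAt_pow 2 t).const_mul (v : ℝ)).div_const 2
      exact this.congr_deriv (by norm_num; ring)
    convert h.exp using 1
    ring
  have step : ∀ {p p' : ℝ → ℝ}, (∀ t, HasDerivAt p (p' t) t) →
      deriv (fun t => p t * Real.exp (v * t ^ 2 / 2)) =
        fun t => (p' t + p t * (v * t)) * Real.exp (v * t ^ 2 / 2) := by
    intro p p' hp
    ext t
    refine ((hp t).mul (hE t)).deriv.trans ?_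
    ring
  have hid : ∀ t : ℝ, HasDerivAt (fun t : ℝ => t) 1 t := fun t => hasDerivAt_id t
  rw [h0, mgf_fun_id_gaussianReal]
  simp only [iteratedDeriv_succ, iteratedDeriv_zero, zero_mul, zero_add]
  rw [funext fun t => (hE t).deriv]
  have h2 : ∀ t : ℝ, HasDerivAt (fun t : ℝ => (v : ℝ) + v * t * (v * t))
      (2 * (v : ℝ) ^ 2 * t) t := by
    intro t
    have h := ((hid t).const_mul (v : ℝ)).mul ((hid t).const_mul (v : ℝ))
    exact (h.const_add (v : ℝ)).congr_deriv (by ring)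
  have h1 : ∀ t : ℝ, HasDerivAt (fun t : ℝ => (v : ℝ) * t) v t := fun t => by
    simpa using (hid t).const_mul (v : ℝ)
  have h3 : ∀ t : ℝ, HasDerivAt (fun t : ℝ => 2 * (v : ℝ) ^ 2 * t +
      (v + v * t * (v * t)) * (v * t)) (3 * (v : ℝ) ^ 2 + 3 * v ^ 3 * t ^ 2) t := by
    intro t
    have h : HasDerivAt (fun t : ℝ => 3 * (v : ℝ) ^ 2 * t + v ^ 3 * t ^ 3)
        (3 * (v : ℝ) ^ 2 * 1 + v ^ 3 * (3 * t ^ 2)) t := by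
      have := ((hasDerivAt_pow 3 t).const_mul ((v : ℝ) ^ 3))
      exact ((hid t).const_mul (3 * (v : ℝ) ^ 2)).add (by simpa using this)
    convert h using 1
    · ext t; ring
    · ring
  rw [step h1, step h2, step h3]
  simp

/-! ### Gaussian vectors with i.i.d. coordinates. -/

open WithLp (toLp)

theorem lintegral_prod_pi {ι : Type*} [Fintype ι] {α : ι → Type*} [∀ i, MeasurableSpace (α i)]
    (μ : ∀ i, Measure (α i)) [∀ i, IsProbabilityMeasure (μ i)] {f : ∀ i, α i → ℝ≥0∞}
    (hf : ∀ i, Measurable (f i)) :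
    ∫⁻ x, ∏ i, f i (x i) ∂Measure.pi μ = ∏ i, ∫⁻ x, f i x ∂μ i := by
  rw [lintegral_prod_eq_prod_lintegral_of_indepFun (X := fun i (x : ∀ i, α i) => f i (x i)) _
    (iIndepFun_pi fun i => (hf i).aemeasurable) fun i => (hf i).comp (measurable_pi_apply i)]
  exact Finset.prod_congr rfl fun i _ =>
    (measurePreserving_eval μ i).lintegral_comp (hf i)

/-- Chernoff's method with lower integrals, so that no integrability has to be checked. -/
theorem measure_le_exp_mul_lintegral_exp {α : Type*} [MeasurableSpace α] (P : Measure α)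
    {S : α → ℝ} {u : ℝ} (hu : 0 ≤ u) (hS : Measurable S) (T : ℝ) :
    P {x | T ≤ S x} ≤
      ENNReal.ofReal (Real.exp (-(u * T))) * ∫⁻ x, ENNReal.ofReal (Real.exp (u * S x)) ∂P := by
  rw [← lintegral_const_mul _ (by fun_prop),
    ← lintegral_indicator_one (measurableSet_le measurable_const hS)]
  refine lintegral_mono fun x => ?_
  by_cases hx : T ≤ S x
  · rw [Set.indicator_of_mem (show x ∈ {x | T ≤ S x} from hx), ← ENNReal.ofReal_mul (by positivity),
      ← Real.exp_add, Pi.one_apply, ENNReal.one_le_ofReal, Real.one_le_exp_iff]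
    have : u * T ≤ u * S x := mul_le_mul_of_nonneg_left hx hu
    linarith
  · rw [Set.indicator_of_notMem (show x ∉ {x | T ≤ S x} from hx)]
    positivity

section PiGaussian

variable {ι : Type*} [Fintype ι]

theorem charFun_map_toLp_pi_gaussianReal (v : ℝ≥0) (t : EuclideanSpace ℝ ι) :
    charFun ((Measure.pi fun _ : ι => gaussianReal 0 v).map (toLp 2)) t =
      Complex.exp (-(v * ‖t‖ ^ 2 / 2 : ℝ)) := by
  simp_rw [charFun_pi, charFun_gaussianReal, ← Complex.exp_sum, EuclideanSpace.real_norm_sq_eq]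
  congr 1
  push_cast
  simp [Finset.sum_div, Finset.mul_sum]

/-- Rotation invariance: the characteristic function depends only on the norm, which an orthonormal
family preserves. -/
theorem map_orthonormal_pi_gaussianReal {κ : Type*} [Fintype κ] (v : ℝ≥0)
    {b : κ → EuclideanSpace ℝ ι} (hb : Orthonormal ℝ b) :
    (Measure.pi fun _ : ι => gaussianReal 0 v).map (fun x k => inner ℝ (b k) (toLp 2 x)) =
      Measure.pi fun _ : κ => gaussianReal 0 v := by
  have : IsProbabilityMeasure ((Measure.pi fun _ : ι => gaussianReal 0 v).map
      (fun x k => inner ℝ (b k) (toLp 2 x))) :=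
    Measure.isProbabilityMeasure_map (Measurable.aemeasurable (by fun_prop))
  refine charFun_eq_pi_iff.1 fun t => ?_
  rw [Measure.map_map (by fun_prop) (by fun_prop)]
  have hR := charFun_map_toLp_pi_gaussianReal v t
  rw [charFun_pi] at hR
  rw [hR]
  have hL := charFun_map_toLp_pi_gaussianReal v (∑ k, t k • b k)
  have hn : ‖∑ k, t k • b k‖ ^ 2 = ‖t‖ ^ 2 := by
    rw [← real_inner_self_eq_norm_sq, hb.inner_sum, EuclideanSpace.real_norm_sq_eq]
    simp [pow_two]
  rw [hn] at hL
  rw [← hL, charFun_apply, charFun_apply, integral_map (by fun_prop) (by fun_prop),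
    integral_map (by fun_prop) (by fun_prop)]
  congr with x
  congr 3
  simp [PiLp.inner_apply (𝕜 := ℝ) (ι := κ), inner_sum, real_inner_smul_right, real_inner_comm]

theorem map_inner_pi_gaussianReal (v : ℝ≥0) (f : EuclideanSpace ℝ ι) :
    (Measure.pi fun _ : ι => gaussianReal 0 v).map (fun x => inner ℝ f (toLp 2 x)) =
      gaussianReal 0 (v * ‖f‖₊ ^ 2) := by
  have : IsProbabilityMeasure ((Measure.pi fun _ : ι => gaussianReal 0 v).map
      (fun x => inner ℝ f (toLp 2 x))) :=
    Measure.isProbabilityMeasure_map (Measurable.aemeasurable (by fun_prop))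
  refine Measure.ext_of_charFun ?_
  ext t
  have hL := charFun_map_toLp_pi_gaussianReal v (t • f)
  rw [charFun_apply, integral_map (by fun_prop) (by fun_prop)] at hL
  rw [charFun_gaussianReal, charFun_apply, integral_map (by fun_prop) (by fun_prop)]
  convert hL using 1
  · congr with x
    simp [real_inner_smul_right, real_inner_comm]
  · congr 1
    have h : ‖t • f‖ ^ 2 = t ^ 2 * ‖f‖ ^ 2 := by rw [norm_smul, mul_pow, Real.norm_eq_abs, sq_abs]
    rw [h]
    simp
    ring

theorem pi_gaussianReal_le_inner_sq_le (v : ℝ≥0) {f : EuclideanSpace ℝ ι} (hf : ‖f‖ ≤ 1)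
    {t : ℝ} (ht : 0 ≤ t) :
    Measure.pi (fun _ : ι => gaussianReal 0 v) {x | t ≤ (inner ℝ f (toLp 2 x)) ^ 2} ≤
      ENNReal.ofReal (Real.exp (-(t / (2 * v)))) := by
  have h := gaussianReal_le_sq_le (v * ‖f‖₊ ^ 2) ht
  rw [← map_inner_pi_gaussianReal, Measure.map_apply (by fun_prop)
    (measurableSet_le measurable_const (by fun_prop))] at h
  -- For zero variance `h` only bounds by 1, again through a division by zero. The law is then a
  -- point mass at 0, so the event is null unless `t = 0`.
  rcases eq_or_ne (v * ‖f‖₊ ^ 2) 0 with h0 | h0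
  · rcases ht.eq_or_lt with rfl | ht
    · simpa using prob_le_one
    · suffices Measure.pi (fun _ : ι => gaussianReal 0 v) {x | t ≤ (inner ℝ f (toLp 2 x)) ^ 2} = 0 by
        simp [this]
      have hm : MeasurableSet {y : ℝ | t ≤ y ^ 2} :=
        measurableSet_le measurable_const (by fun_prop)
      have := Measure.map_apply (μ := Measure.pi fun _ : ι => gaussianReal 0 v)
        (f := fun x => inner ℝ f (toLp 2 x)) (by fun_prop) hm
      rw [map_inner_pi_gaussianReal, h0, gaussianReal_zero_var, Measure.dirac_apply' _ hm] at this
      simpa [ht, not_le.2 ht] using this.symm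
  · refine h.trans (ENNReal.ofReal_le_ofReal (Real.exp_le_exp.2 (neg_le_neg ?_)))
    have hpos : 0 < v * ‖f‖₊ ^ 2 := pos_iff_ne_zero.2 h0
    have hpos' : (0 : ℝ) < ((v * ‖f‖₊ ^ 2 : ℝ≥0) : ℝ) := by exact_mod_cast hpos
    refine div_le_div_of_nonneg_left ht (by positivity) ?_
    push_cast
    have : ‖f‖ ^ 2 ≤ 1 := pow_le_one₀ (norm_nonneg _) hf
    nlinarith [v.2]

theorem lintegral_exp_neg_mul_sum_sq_le {v : ℝ≥0} (hv : v ≠ 0) {c : ℝ} (a : ι → ℝ)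
    (hc : 0 < 1 + 2 * c * v) (hca : ∀ i, 0 ≤ c * a i ^ 2) :
    ∫⁻ x, ENNReal.ofReal (Real.exp (-(c * ∑ i, (a i + x i) ^ 2)))
        ∂Measure.pi (fun _ : ι => gaussianReal 0 v) ≤
      ENNReal.ofReal ((Real.sqrt (1 + 2 * c * v))⁻¹ ^ Fintype.card ι) := by
  have h : ∀ x : ι → ℝ, ENNReal.ofReal (Real.exp (-(c * ∑ i, (a i + x i) ^ 2))) =
      ∏ i, ENNReal.ofReal (Real.exp (-(c * (a i + x i) ^ 2))) := fun x => by
    rw [← ENNReal.ofReal_prod_of_nonneg fun _ _ => (Real.exp_pos _).le, ← Real.exp_sum,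
      Finset.mul_sum, Finset.sum_neg_distrib]
  simp_rw [h]
  rw [lintegral_prod_pi _ (f := fun i y => ENNReal.ofReal (Real.exp (-(c * (a i + y) ^ 2))))
    fun i => by fun_prop, ENNReal.ofReal_pow (by positivity), ← Finset.card_univ]
  exact Finset.prod_le_pow_card _ _ _ fun i _ =>
    lintegral_exp_neg_mul_sq_gaussianReal_le hv hc (hca i)

/-- In an orthonormal basis of `K` the projection has independent shifted Gaussian coordinates. Only
the dimension of `K` enters the bound, which is what makes conditioning possible later. -/
theorem lintegral_exp_neg_mul_norm_starProjection_sq_le {v : ℝ≥0} (hv : v ≠ 0) {c : ℝ}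
    (hc : 0 ≤ c) (K : Submodule ℝ (EuclideanSpace ℝ ι)) (a : EuclideanSpace ℝ ι) :
    ∫⁻ x, ENNReal.ofReal (Real.exp (-(c * ‖K.starProjection (a + toLp 2 x)‖ ^ 2)))
        ∂Measure.pi (fun _ : ι => gaussianReal 0 v) ≤
      ENNReal.ofReal ((Real.sqrt (1 + 2 * c * v))⁻¹ ^ Module.finrank ℝ K) := by
  let b := stdOrthonormalBasis ℝ K
  have hb : Orthonormal ℝ fun k => (b k : EuclideanSpace ℝ ι) :=
    b.orthonormal.comp_linearIsometry K.subtypeₗᵢ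
  have key : ∀ y : EuclideanSpace ℝ ι, ‖K.starProjection y‖ ^ 2 =
      ∑ k, (inner ℝ (b k : EuclideanSpace ℝ ι) y) ^ 2 := fun y => by
    have h1 : ‖K.starProjection y‖ = ‖K.orthogonalProjectionOnto y‖ := by
      rw [Submodule.starProjection_apply]; simp
    rw [h1, ← b.sum_sq_norm_inner_right]
    refine Finset.sum_congr rfl fun k _ => ?_
    rw [Real.norm_eq_abs, sq_abs, Submodule.inner_orthogonalProjectionOnto_eq_of_mem_left]
  have h := lintegral_exp_neg_mul_sum_sq_le (ι := Fin (Module.finrank ℝ K)) hv (c := c)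
    (fun k => inner ℝ (b k : EuclideanSpace ℝ ι) a) (by positivity) (fun k => by positivity)
  rw [Fintype.card_fin, ← map_orthonormal_pi_gaussianReal v hb,
    lintegral_map (by fun_prop) (by fun_prop)] at h
  simpa only [key, inner_add_right] using h

theorem pi_gaussianReal_le_sum_sq_le {v : ℝ≥0} (hv : v ≠ 0) {u : ℝ} (hu : 0 ≤ u)
    (huv : 2 * u * v < 1) (T : ℝ) :
    Measure.pi (fun _ : ι => gaussianReal 0 v) {x | T ≤ ∑ i, x i ^ 2} ≤
      ENNReal.ofReal (Real.exp (-(u * T)) * (Real.sqrt (1 - 2 * u * v))⁻¹ ^ Fintype.card ι) := by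
  have h := lintegral_exp_neg_mul_sum_sq_le (ι := ι) hv (c := -u) (fun _ => 0)
    (by linarith) (fun _ => by simp)
  simp only [zero_add, neg_mul, neg_neg] at h
  refine (measure_le_exp_mul_lintegral_exp _ hu (by fun_prop) T).trans ?_
  rw [ENNReal.ofReal_mul (by positivity)]
  gcongr
  simpa only [mul_neg, neg_mul, ← sub_eq_add_neg] using h

theorem memLp_sq_gaussianReal (v : ℝ≥0) : MemLp (fun x : ℝ => x ^ 2) 2 (gaussianReal 0 v) := by
  have h := (memLp_id_gaussianReal' (μ := 0) (v := v) 4 (by simp)).norm_rpow_div 2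
  have h2 : (4 : ℝ≥0∞) / 2 = 2 := by
    rw [← ENNReal.toReal_eq_toReal_iff' (by finiteness) (by simp)]
    norm_num
  simpa [h2] using h

theorem integral_sq_gaussianReal (v : ℝ≥0) : ∫ x, x ^ 2 ∂gaussianReal 0 v = v := by
  have := variance_fun_id_gaussianReal (μ := 0) (v := v)
  rw [variance_eq_integral measurable_id'.aemeasurable] at this
  simpa using this

theorem variance_sq_gaussianReal (v : ℝ≥0) :
    Var[fun x : ℝ => x ^ 2; gaussianReal 0 v] = 2 * (v : ℝ) ^ 2 := by
  rw [variance_eq_sub (memLp_sq_gaussianReal v)]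
  have h : ∀ x : ℝ, (x ^ 2) ^ 2 = x ^ 4 := fun x => by ring
  simp only [Pi.pow_apply, h, integral_pow_four_gaussianReal, integral_sq_gaussianReal]
  ring

theorem integral_sum_sq_sub_sq_pi_gaussianReal (v : ℝ≥0) (κ : ℝ) :
    ∫ x, (∑ i, x i ^ 2 - κ) ^ 2 ∂Measure.pi (fun _ : ι => gaussianReal 0 v) =
      Fintype.card ι * (2 * (v : ℝ) ^ 2) + (Fintype.card ι * v - κ) ^ 2 := by
  set P := Measure.pi (fun _ : ι => gaussianReal 0 v)
  have hmem : ∀ i : ι, MemLp (fun x : ι → ℝ => x i ^ 2) 2 P := fun i =>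
    (memLp_sq_gaussianReal v).comp_measurePreserving
      (measurePreserving_eval (fun _ : ι => gaussianReal 0 v) i)
  have hS : MemLp (fun x : ι → ℝ => ∑ i, x i ^ 2) 2 P := memLp_finsetSum _ fun i _ => hmem i
  have hvar : Var[fun x : ι → ℝ => ∑ i, x i ^ 2; P] = Fintype.card ι * (2 * (v : ℝ) ^ 2) := by
    have h := variance_sum_pi (μ := fun _ : ι => gaussianReal 0 v)
      (X := fun _ x => x ^ 2) fun _ => memLp_sq_gaussianReal v
    simp only [variance_sq_gaussianReal, Finset.sum_const, Finset.card_univ, nsmul_eq_mul] at h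
    rw [← h]
    congr 1
    ext x
    simp
  have hmean : ∫ x, ∑ i, x i ^ 2 ∂P = Fintype.card ι * v := by
    rw [integral_finsetSum _ fun i _ => (hmem i).integrable (by norm_num)]
    have h1 : ∀ i : ι, ∫ x, x i ^ 2 ∂P = v := fun i => by
      have h := measurePreserving_eval (fun _ : ι => gaussianReal 0 v) i
      rw [← integral_sq_gaussianReal v, ← h.map_eq, integral_map h.aemeasurable (by fun_prop)]
    simp [h1]
  have h := variance_eq_sub (hS.sub (memLp_const κ))
  have h2 : Var[(fun x : ι → ℝ => ∑ i, x i ^ 2) - fun _ => κ; P] =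
      Var[fun x : ι → ℝ => ∑ i, x i ^ 2; P] := variance_sub_const hS.aestronglyMeasurable κ
  rw [h2, hvar] at h
  have h3 : ∫ x, ((fun x : ι → ℝ => ∑ i, x i ^ 2) - fun _ : ι → ℝ => κ) x ∂P =
      Fintype.card ι * v - κ := by
    simp only [Pi.sub_apply]
    rw [integral_sub (hS.integrable (by norm_num)) (integrable_const _), hmean]
    simp
  rw [h3] at h
  simp only [Pi.pow_apply, Pi.sub_apply] at h
  linarith

/-- A second moment bound about `5 n v / 4` for the sum of squares of `n` Gaussians. -/
theorem pi_gaussianReal_sum_sq_outside_le [Nonempty ι] {v : ℝ≥0} (hv : v ≠ 0) :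
    Measure.pi (fun _ : ι => gaussianReal 0 v)
      {x | ∑ i, x i ^ 2 ≤ Fintype.card ι * v / 2 ∨ 2 * (Fintype.card ι * v) ≤ ∑ i, x i ^ 2} ≤
      ENNReal.ofReal ((32 / Fintype.card ι + 1) / 9) := by
  set P := Measure.pi (fun _ : ι => gaussianReal 0 v)
  set n : ℝ := (Fintype.card ι : ℝ) with hn
  have hn0 : 0 < n := by rw [hn]; exact_mod_cast Fintype.card_pos
  have hv0 : (0 : ℝ) < v := by positivity
  have hmem : ∀ i : ι, MemLp (fun x : ι → ℝ => x i ^ 2) 2 P := fun i =>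
    (memLp_sq_gaussianReal v).comp_measurePreserving
      (measurePreserving_eval (fun _ : ι => gaussianReal 0 v) i)
  have hS : MemLp (fun x : ι → ℝ => ∑ i, x i ^ 2) 2 P := memLp_finsetSum _ fun i _ => hmem i
  have hint : Integrable (fun x : ι → ℝ => (∑ i, x i ^ 2 - 5 / 4 * (n * v)) ^ 2) P :=
    (hS.sub (memLp_const _)).integrable_sq
  have hmk := mul_meas_ge_le_integral_of_nonneg (μ := P)
    (Filter.Eventually.of_forall fun x => sq_nonneg (∑ i, x i ^ 2 - 5 / 4 * (n * v))) hint
    ((3 / 4 * (n * v)) ^ 2)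
  rw [integral_sum_sq_sub_sq_pi_gaussianReal] at hmk
  -- Chebyshev about 5/4, the midpoint of [1/2, 2], with half-width 3/4; centring at the mean would
  -- leave only the distance 1/2 on the left.
  have hsub : {x : ι → ℝ | ∑ i, x i ^ 2 ≤ n * v / 2 ∨ 2 * (n * v) ≤ ∑ i, x i ^ 2} ⊆
      {x | (3 / 4 * (n * v)) ^ 2 ≤ (∑ i, x i ^ 2 - 5 / 4 * (n * v)) ^ 2} := by
    intro x hx
    have hnv : 0 < n * v := by positivity
    simp only [Set.mem_ofPred_eq] at hx ⊢
    rcases hx with h | h <;> nlinarith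
  refine (measure_mono hsub).trans ?_
  rw [← ofReal_measureReal]
  refine ENNReal.ofReal_le_ofReal ?_
  rw [← mul_le_mul_iff_right₀ (show 0 < (3 / 4 * (n * (v : ℝ))) ^ 2 by positivity)]
  refine hmk.trans (le_of_eq ?_)
  rw [← hn]
  field_simp
  ring

end PiGaussian

/-! ### The covariance matrix and the residual direction. -/

open scoped Matrix

theorem dotProduct_mulVec_comm_of_isHermitian {ι : Type*} [Fintype ι] {S : Matrix ι ι ℝ}
    (hS : S.IsHermitian) (x y : ι → ℝ) :
    x ⬝ᵥ S *ᵥ y = y ⬝ᵥ S *ᵥ x := by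
  have h : Sᵀ = S := by simpa using hS.eq
  rw [Matrix.dotProduct_mulVec, ← Matrix.mulVec_transpose, h, dotProduct_comm]

section Matrix

variable {ι : Type*} [Fintype ι] [DecidableEq ι]

/-- The residual direction of the `i`-th coordinate: if `x ∼ 𝒩(0, S)`, then `⟨c, x⟩` is the residual
of `x i` after linear regression on the other coordinates. -/
noncomputable def residualDirection (S : Matrix ι ι ℝ) (i : ι) : ι → ℝ :=
  (1 / S⁻¹ i i) • (S⁻¹ *ᵥ Pi.single i 1)

variable {S : Matrix ι ι ℝ}

theorem inv_diag_pos (hS : S.PosDef) (i : ι) : 0 < 1 / S⁻¹ i i :=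
  one_div_pos.2 hS.inv.diag_pos

theorem residualDirection_self (hS : S.PosDef) (i : ι) : residualDirection S i i = 1 := by
  have := (one_div_pos.1 (inv_diag_pos hS i)).ne'
  simp [residualDirection, this]

theorem mulVec_residualDirection (hS : S.PosDef) (i : ι) :
    S *ᵥ residualDirection S i = Pi.single i (1 / S⁻¹ i i) := by
  have hdet : IsUnit S.det := (Matrix.isUnit_iff_isUnit_det S).1 hS.isUnit
  rw [residualDirection, Matrix.mulVec_smul, Matrix.mulVec_mulVec, Matrix.mul_nonsing_inv _ hdet,
    Matrix.one_mulVec]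
  ext j
  by_cases h : j = i
  · subst h; simp
  · simp [h]

theorem residualDirection_dotProduct_mulVec (hS : S.PosDef) (i : ι) :
    residualDirection S i ⬝ᵥ S *ᵥ residualDirection S i = 1 / S⁻¹ i i := by
  rw [mulVec_residualDirection hS, dotProduct_single, residualDirection_self hS, one_mul]

theorem dotProduct_sub_single_mulVec (m : ℝ) (i : ι) (x : ι → ℝ) :
    x ⬝ᵥ (S - Matrix.single i i m) *ᵥ x = x ⬝ᵥ S *ᵥ x - m * x i ^ 2 := by
  rw [Matrix.sub_mulVec, dotProduct_sub, Matrix.single_mulVec]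
  simp [Function.update_apply, dotProduct]
  ring

/-- With c the residual direction and m = 1/(S⁻¹)ᵢᵢ, expanding the form of S at x - xᵢ c gives xᵀSx
- m xᵢ², which is thus nonnegative. -/
theorem posSemidef_sub_single (hS : S.PosDef) (i : ι) :
    (S - Matrix.single i i (1 / S⁻¹ i i)).PosSemidef := by
  refine .of_dotProduct_mulVec_nonneg ?_ fun x => ?_
  · refine hS.isHermitian.sub ?_
    rw [Matrix.IsHermitian, Matrix.conjTranspose_single]
    simp
  · rw [star_trivial, dotProduct_sub_single_mulVec]
    set c := residualDirection S i
    have h := hS.posSemidef.dotProduct_mulVec_nonneg (x - x i • c)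
    have h1 := residualDirection_dotProduct_mulVec hS i
    have h2 : x ⬝ᵥ S *ᵥ c = 1 / S⁻¹ i i * x i := by
      rw [mulVec_residualDirection hS, dotProduct_single, mul_comm]
    have h3 := dotProduct_mulVec_comm_of_isHermitian hS.isHermitian c x
    simp only [star_trivial, Matrix.mulVec_sub, Matrix.mulVec_smul, dotProduct_sub,
      sub_dotProduct, smul_dotProduct, dotProduct_smul, smul_eq_mul] at h
    rw [h3, h2, h1] at h
    linarith

end Matrix

/-! ### Laws of the covariates and of the sample; the population loss. -/

section Laws

variable {d : ℕ}

theorem map_inner_multivariateGaussian {S : Matrix (Fin d) (Fin d) ℝ} (hS : S.PosSemidef)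
    (c : EuclideanSpace ℝ (Fin d)) :
    (multivariateGaussian 0 S).map (fun x => inner ℝ x c) =
      gaussianReal 0 (Real.toNNReal (c ⬝ᵥ S *ᵥ c)) := by
  have : IsProbabilityMeasure ((multivariateGaussian 0 S).map (fun x => inner ℝ x c)) :=
    Measure.isProbabilityMeasure_map (Measurable.aemeasurable (by fun_prop))
  refine Measure.ext_of_charFun ?_
  ext t
  have hL := charFun_multivariateGaussian (μ := 0) hS (t • c)
  rw [charFun_apply] at hL
  have h0 : 0 ≤ c ⬝ᵥ S *ᵥ c := by
    simpa using hS.dotProduct_mulVec_nonneg (c : Fin d → ℝ)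
  rw [charFun_gaussianReal, charFun_apply, integral_map (by fun_prop) (by fun_prop)]
  convert hL using 1
  · congr with x
    simp [real_inner_smul_right]
  · congr 1
    simp [Real.coe_toNNReal _ h0, Matrix.mulVec_smul]
    ring

/-- Splits off independent noise in coordinate `i` with the largest variance that the previous
positivity allows. The other coordinates do not see this noise. -/
theorem multivariateGaussian_eq_map_add_smul_single {S : Matrix (Fin d) (Fin d) ℝ}
    (hS : S.PosDef) (i : Fin d) :
    multivariateGaussian 0 S =
      ((multivariateGaussian 0 (S - Matrix.single i i (1 / S⁻¹ i i))).prod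
        (gaussianReal 0 (Real.toNNReal (1 / S⁻¹ i i)))).map
        fun p => p.1 + p.2 • EuclideanSpace.single i (1 : ℝ) := by
  set m := 1 / S⁻¹ i i with hm
  have hm0 : 0 < m := inv_diag_pos hS i
  have hR := posSemidef_sub_single hS i
  rw [← hm] at hR
  set ν := multivariateGaussian 0 (S - Matrix.single i i m)
  have : IsProbabilityMeasure ((ν.prod (gaussianReal 0 m.toNNReal)).map
      fun p => p.1 + p.2 • EuclideanSpace.single i (1 : ℝ)) :=
    Measure.isProbabilityMeasure_map (Measurable.aemeasurable (by fun_prop))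
  refine Measure.ext_of_charFun ?_
  ext t
  rw [charFun_multivariateGaussian hS.posSemidef, charFun_apply,
    integral_map (by fun_prop) (by fun_prop)]
  have h : ∀ p : EuclideanSpace ℝ (Fin d) × ℝ,
      Complex.exp ((inner ℝ (p.1 + p.2 • EuclideanSpace.single i (1 : ℝ)) t : ℝ) * Complex.I) =
      Complex.exp ((inner ℝ p.1 t : ℝ) * Complex.I) *
        Complex.exp ((inner ℝ p.2 (t i) : ℝ) * Complex.I) := fun p => by
    rw [← Complex.exp_add]
    congr 1
    simp [inner_add_left, real_inner_smul_left, add_mul, EuclideanSpace.inner_single_left]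
    ring
  simp_rw [h]
  rw [integral_prod_mul (μ := ν) (ν := gaussianReal 0 m.toNNReal)
    (fun x => Complex.exp ((inner ℝ x t : ℝ) * Complex.I))
    (fun r => Complex.exp ((inner ℝ r (t i) : ℝ) * Complex.I)), ← charFun_apply, ← charFun_apply,
    charFun_multivariateGaussian hR, charFun_gaussianReal, ← Complex.exp_add,
    dotProduct_sub_single_mulVec]
  congr 1
  simp [Real.coe_toNNReal _ hm0.le]
  ring

theorem pi_map_prod_eq_map {ι α β γ : Type*} [Fintype ι] [MeasurableSpace α] [MeasurableSpace β]
    [MeasurableSpace γ] (μ : Measure α) (ν : Measure β) [IsProbabilityMeasure μ]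
    [IsProbabilityMeasure ν] {f : α × β → γ} (hf : Measurable f) :
    (Measure.pi fun _ : ι => (μ.prod ν).map f) =
      ((Measure.pi fun _ : ι => μ).prod (Measure.pi fun _ : ι => ν)).map
        fun p i => f (p.1 i, p.2 i) := by
  have : IsProbabilityMeasure ((μ.prod ν).map f) := Measure.isProbabilityMeasure_map hf.aemeasurable
  have h := (measurePreserving_arrowProdEquivProdArrow α β ι (fun _ => μ) (fun _ => ν)).symm
  rw [← Measure.pi_map_pi (μ := fun _ : ι => μ.prod ν) (f := fun _ => f) fun _ => hf.aemeasurable,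
    ← h.map_eq, Measure.map_map (by fun_prop) h.measurable]
  rfl

variable (S : Matrix (Fin d) (Fin d) ℝ) (s : ℝ) (θ : EuclideanSpace ℝ (Fin d)) (n : ℕ)

theorem sampleLaw_regressionTask :
    (regressionTask S s θ).sampleLaw n =
      ((Measure.pi fun _ : Fin n => multivariateGaussian 0 S).prod
        (Measure.pi fun _ : Fin n => gaussianReal 0 (Real.toNNReal (s ^ 2)))).map
        fun p j => (p.1 j, inner ℝ (p.1 j) θ + p.2 j) :=
  pi_map_prod_eq_map _ _ (f := fun p => (p.1, inner ℝ p.1 θ + p.2)) (by fun_prop)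

variable {S}

theorem pi_multivariateGaussian_eq_map (hS : S.PosDef) (i : Fin d) :
    (Measure.pi fun _ : Fin n => multivariateGaussian 0 S) =
      ((Measure.pi fun _ : Fin n =>
        multivariateGaussian 0 (S - Matrix.single i i (1 / S⁻¹ i i))).prod
        (Measure.pi fun _ : Fin n => gaussianReal 0 (Real.toNNReal (1 / S⁻¹ i i)))).map
        fun p j => p.1 j + p.2 j • EuclideanSpace.single i (1 : ℝ) := by
  conv_lhs => rw [multivariateGaussian_eq_map_add_smul_single hS i]
  exact pi_map_prod_eq_map _ _ (f := fun p => p.1 + p.2 • EuclideanSpace.single i (1 : ℝ))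
    (by fun_prop)

theorem map_residual_pi_multivariateGaussian (hS : S.PosDef) (i : Fin d) :
    (Measure.pi fun _ : Fin n => multivariateGaussian 0 S).map
        (fun x j => inner ℝ (x j) (toLp 2 (residualDirection S i))) =
      Measure.pi fun _ : Fin n => gaussianReal 0 (Real.toNNReal (1 / S⁻¹ i i)) := by
  have h := map_inner_multivariateGaussian hS.posSemidef (toLp 2 (residualDirection S i))
  rw [show (toLp 2 (residualDirection S i)).ofLp = residualDirection S i from rfl,
    residualDirection_dotProduct_mulVec hS] at h
  have : IsProbabilityMeasure ((multivariateGaussian 0 S).map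
      (fun x => inner ℝ x (toLp 2 (residualDirection S i)))) :=
    Measure.isProbabilityMeasure_map (Measurable.aemeasurable (by fun_prop))
  rw [← h]
  exact Measure.pi_map_pi (f := fun _ x => inner ℝ x (toLp 2 (residualDirection S i)))
    fun _ => Measurable.aemeasurable (by fun_prop)

/-- The prediction error is a sum of two independent centred Gaussians, so the loss is the sum of
their variances. -/
theorem popLoss_regressionTask (hS : S.PosSemidef) (θ' : EuclideanSpace ℝ (Fin d)) :
    (regressionTask S s θ).popLoss θ' =
      ENNReal.ofReal ((θ' - θ).ofLp ⬝ᵥ S *ᵥ (θ' - θ).ofLp + s ^ 2) := by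
  have h0 : 0 ≤ (θ' - θ).ofLp ⬝ᵥ S *ᵥ (θ' - θ).ofLp := by
    simpa using hS.dotProduct_mulVec_nonneg (θ' - θ).ofLp
  set Q := (θ' - θ).ofLp ⬝ᵥ S *ᵥ (θ' - θ).ofLp with hQ
  have hlaw : ((multivariateGaussian 0 S).prod (gaussianReal 0 (Real.toNNReal (s ^ 2)))).map
      (fun p => inner ℝ p.1 (θ' - θ) + -p.2) = gaussianReal 0 (Q.toNNReal + (s ^ 2).toNNReal) := by
    have h1 : (multivariateGaussian 0 S).map (fun x => inner ℝ x (θ' - θ)) =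
      gaussianReal 0 Q.toNNReal := map_inner_multivariateGaussian hS _
    have h2 : (gaussianReal 0 (Real.toNNReal (s ^ 2))).map (fun y => -y) =
        gaussianReal 0 (Real.toNNReal (s ^ 2)) := by
      rw [gaussianReal_map_neg, neg_zero]
    have h3 := gaussianReal_conv_gaussianReal (m₁ := 0) (m₂ := 0) (v₁ := Q.toNNReal)
      (v₂ := (s ^ 2).toNNReal)
    rw [add_zero] at h3
    rw [← h3, Measure.conv, ← h1]
    nth_rw 2 [← h2]
    rw [Measure.map_prod_map _ _ (by fun_prop) (by fun_prop),
      Measure.map_map (by fun_prop) (by fun_prop)]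
    rfl
  have hint : Integrable (fun x : ℝ => x ^ 2) (gaussianReal 0 (Q.toNNReal + (s ^ 2).toNNReal)) :=
    (memLp_sq_gaussianReal _).integrable (by norm_num)
  calc (regressionTask S s θ).popLoss θ'
      = ∫⁻ z, ENNReal.ofReal ((inner ℝ z.1 θ' - z.2) ^ 2) ∂(regressionLaw S s θ) := rfl
    _ = ∫⁻ x, ENNReal.ofReal (x ^ 2) ∂gaussianReal 0 (Q.toNNReal + (s ^ 2).toNNReal) := by
      rw [← hlaw, regressionLaw, lintegral_map (by fun_prop) (by fun_prop),
        lintegral_map (by fun_prop) (by fun_prop)]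
      refine lintegral_congr fun p => ?_
      congr 2
      rw [inner_sub_right]
      ring
    _ = _ := by
      rw [← ofReal_integral_eq_lintegral_ofReal hint (.of_forall fun x => sq_nonneg x),
        integral_sq_gaussianReal]
      congr 1
      simp [h0, sq_nonneg]

theorem regressionTask_isPopMinimizer_self (hS : S.PosSemidef) :
    (regressionTask S s θ).IsPopMinimizer θ := by
  refine ⟨Set.mem_univ _, fun θ' _ => ?_⟩
  rw [popLoss_regressionTask s θ hS, popLoss_regressionTask s θ hS]
  refine ENNReal.ofReal_le_ofReal ?_
  have h0 : 0 ≤ (θ' - θ).ofLp ⬝ᵥ S *ᵥ (θ' - θ).ofLp := by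
    simpa using hS.dotProduct_mulVec_nonneg (θ' - θ).ofLp
  simpa using h0

theorem regressionTask_isPopMinimizer_iff (hS : S.PosDef) (θ' : EuclideanSpace ℝ (Fin d)) :
    (regressionTask S s θ).IsPopMinimizer θ' ↔ θ' = θ := by
  refine ⟨fun h => ?_, fun h => h ▸ regressionTask_isPopMinimizer_self s θ hS.posSemidef⟩
  have h1 := h.2 θ (Set.mem_univ _)
  rw [popLoss_regressionTask s θ hS.posSemidef, popLoss_regressionTask s θ hS.posSemidef,
    ENNReal.ofReal_le_ofReal_iff (by simp [sq_nonneg])] at h1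
  by_contra hne
  have h2 : (θ' - θ).ofLp ≠ 0 := fun h0 => hne (by
    rw [← sub_eq_zero]; ext j; exact congrFun h0 j)
  have h3 := hS.dotProduct_mulVec_pos h2
  simp only [star_trivial] at h3
  simp at h1
  simp at h3
  linarith

end Laws

/-! ### Least squares as orthogonal projection. -/

section LeastSquares

variable {E F : Type*} [NormedAddCommGroup E] [InnerProductSpace ℝ E]
  [NormedAddCommGroup F] [InnerProductSpace ℝ F] [FiniteDimensional ℝ F]

theorem starProjection_orthogonal_congr {W W' : Submodule ℝ F} (h : W = W') (y : F) :
    Wᗮ.starProjection y = W'ᗮ.starProjection y := by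
  subst h
  rfl

theorem starProjection_orthogonal_add (W : Submodule ℝ F) {w : F} (hw : w ∈ W) (y : F) :
    Wᗮ.starProjection (y + w) = Wᗮ.starProjection y := by
  have h : Wᗮ.starProjection w = 0 :=
    (Submodule.starProjection_apply_eq_zero_iff _).2 (by simpa using hw)
  rw [map_add, h, add_zero]

/-- Constrained least squares: the minimum over an affine subspace, as the squared norm of a
projection. -/
theorem isLeast_norm_sub_sq (A : E →ₗ[ℝ] F) (U : Submodule ℝ E) (θ₀ : E) (y : F) :
    IsLeast {v | ∃ θ, θ - θ₀ ∈ U ∧ v = ‖A θ - y‖ ^ 2}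
      (‖(U.map A)ᗮ.starProjection (A θ₀ - y)‖ ^ 2) := by
  set W := U.map A
  constructor
  · have hmem : W.starProjection (y - A θ₀) ∈ W := Submodule.starProjection_apply_mem _ _
    obtain ⟨u, hu, hAu⟩ := Submodule.mem_map.1 hmem
    refine ⟨θ₀ + u, by simpa using hu, ?_⟩
    congr 2
    rw [Submodule.starProjection_orthogonal_val, map_add, hAu, ← neg_sub y, map_neg]
    abel
  · rintro v ⟨θ, hθ, rfl⟩
    have hmem : A (θ - θ₀) ∈ W := Submodule.mem_map_of_mem hθ
    have h := starProjection_orthogonal_add W hmem (A θ₀ - y)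
    rw [← h, map_sub, show A θ₀ - y + (A θ - A θ₀) = A θ - y by abel]
    gcongr
    exact Submodule.norm_starProjection_apply_le _ _

theorem norm_starProjection_smul_sub_sq (K : Submodule ℝ F) (a y : F) (w : ℝ) :
    ‖K.starProjection (w • a - y)‖ ^ 2 =
      w ^ 2 * ‖K.starProjection a‖ ^ 2 - 2 * w * inner ℝ (K.starProjection a) y +
        ‖K.starProjection y‖ ^ 2 := by
  have h : inner ℝ (K.starProjection a) (K.starProjection y) = inner ℝ (K.starProjection a) y := by
    rw [← Submodule.inner_starProjection_left_eq_right,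
      Submodule.starProjection_eq_self_iff.2 (Submodule.starProjection_apply_mem K a)]
  rw [map_sub, map_smul, norm_sub_sq_real, norm_smul, real_inner_smul_left, h, mul_pow,
    Real.norm_eq_abs, sq_abs]
  ring

/-- One extra regressor `a` lowers the residual sum of squares by a squared inner product. The
vector `f` is the normalized projection of `a` (or 0 if that vanishes), and it does not depend on
`y`. -/
theorem exists_isLeast_norm_starProjection_smul_sub_sq (K : Submodule ℝ F) (a : F) :
    ∃ f ∈ K, ‖f‖ ≤ 1 ∧ ∀ y, IsLeast (Set.range fun w : ℝ => ‖K.starProjection (w • a - y)‖ ^ 2)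
      (‖K.starProjection y‖ ^ 2 - (inner ℝ f y) ^ 2) := by
  set v := K.starProjection a with hv
  have hvK : v ∈ K := Submodule.starProjection_apply_mem K a
  refine ⟨‖v‖⁻¹ • v, K.smul_mem _ hvK, ?_, fun y => ?_⟩
  · rw [norm_smul, norm_inv, norm_norm]
    exact inv_mul_le_one
  · simp only [norm_starProjection_smul_sub_sq, ← hv, real_inner_smul_left]
    rcases eq_or_ne v 0 with h0 | h0
    · simp [h0]
    · have hn : ‖v‖ ≠ 0 := norm_ne_zero_iff.2 h0
      refine ⟨⟨inner ℝ v y / ‖v‖ ^ 2, ?_⟩, ?_⟩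
      · simp only
        field_simp
        ring
      · rintro _ ⟨w, rfl⟩
        have : w ^ 2 * ‖v‖ ^ 2 - 2 * w * inner ℝ v y + (‖v‖⁻¹ * inner ℝ v y) ^ 2 =
            (w * ‖v‖ - ‖v‖⁻¹ * inner ℝ v y) ^ 2 := by
          field_simp
          ring
        nlinarith [sq_nonneg (w * ‖v‖ - ‖v‖⁻¹ * inner ℝ v y)]

theorem norm_starProjection_smul_sub_sq_sub_of_forall_le (K : Submodule ℝ F) (a y : F) {w₀ : ℝ}
    (h : ∀ w : ℝ, ‖K.starProjection (w₀ • a - y)‖ ^ 2 ≤ ‖K.starProjection (w • a - y)‖ ^ 2)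
    (w : ℝ) :
    ‖K.starProjection (w • a - y)‖ ^ 2 - ‖K.starProjection (w₀ • a - y)‖ ^ 2 =
      ‖K.starProjection a‖ ^ 2 * (w - w₀) ^ 2 := by
  simp only [norm_starProjection_smul_sub_sq] at h ⊢
  set v := K.starProjection a
  set b := 2 * (w₀ * ‖v‖ ^ 2 - inner ℝ v y) with hb
  -- The excess at w₀ + x is ‖v‖² x² + b x ≥ 0, so b² ≤ 0; this also covers v = 0, where minimizers
  -- are not unique.
  have hd := discrim_le_zero (a := ‖v‖ ^ 2) (b := b) (c := 0) fun x => by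
    have := h (w₀ + x)
    nlinarith
  rw [discrim, mul_zero, sub_zero] at hd
  have hb0 : b = 0 := by nlinarith [sq_nonneg b]
  have : w₀ * ‖v‖ ^ 2 - inner ℝ v y = 0 := by linarith
  linear_combination (2 * (w - w₀)) * this

end LeastSquares

/-! ### The design matrix and the residual of its first column. -/

section Design

variable {d n : ℕ}

/-- The linear map of a design matrix with rows `X j`. -/
noncomputable def design (X : Fin n → EuclideanSpace ℝ (Fin d)) :
    EuclideanSpace ℝ (Fin d) →ₗ[ℝ] EuclideanSpace ℝ (Fin n) :=
  (WithLp.linearEquiv 2 ℝ (Fin n → ℝ)).symm.toLinearMap ∘ₗ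
    LinearMap.pi fun j => (innerₛₗ ℝ (X j))

@[simp]
theorem design_apply (X : Fin n → EuclideanSpace ℝ (Fin d)) (θ : EuclideanSpace ℝ (Fin d))
    (j : Fin n) : design X θ j = inner ℝ (X j) θ := rfl

variable [NeZero d]

/-- The parameters with vanishing first coordinate. -/
noncomputable def coordKer (d : ℕ) [NeZero d] : Submodule ℝ (EuclideanSpace ℝ (Fin d)) :=
  LinearMap.ker (EuclideanSpace.proj (𝕜 := ℝ) (0 : Fin d)).toLinearMap

@[simp]
theorem mem_coordKer {θ : EuclideanSpace ℝ (Fin d)} : θ ∈ coordKer d ↔ θ 0 = 0 := by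
  simp [coordKer]

theorem finrank_coordKer : Module.finrank ℝ (coordKer d) + 1 = d := by
  have h := LinearMap.finrank_range_add_finrank_ker
    (EuclideanSpace.proj (𝕜 := ℝ) (0 : Fin d)).toLinearMap
  have hr : LinearMap.range (EuclideanSpace.proj (𝕜 := ℝ) (0 : Fin d)).toLinearMap = ⊤ := by
    rw [LinearMap.range_eq_top]
    exact fun y => ⟨EuclideanSpace.single 0 y, by simp⟩
  rw [hr, finrank_top, finrank_euclideanSpace, Module.finrank_self, Fintype.card_fin] at h
  rw [coordKer]
  omega

/-- The span of the columns of the design matrix other than the first. -/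
noncomputable def otherSpan (X : Fin n → EuclideanSpace ℝ (Fin d)) :
    Submodule ℝ (EuclideanSpace ℝ (Fin n)) :=
  (coordKer d).map (design X)

/-- The first column of the design matrix, projected onto the orthogonal complement of the other
columns. -/
noncomputable def firstResidual (X : Fin n → EuclideanSpace ℝ (Fin d)) :
    EuclideanSpace ℝ (Fin n) :=
  (otherSpan X)ᗮ.starProjection (design X (EuclideanSpace.single 0 1))

theorem le_finrank_otherSpan_orthogonal (X : Fin n → EuclideanSpace ℝ (Fin d)) :
    n + 1 ≤ Module.finrank ℝ (otherSpan X)ᗮ + d := by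
  have h1 := (otherSpan X).finrank_add_finrank_orthogonal
  have h2 : Module.finrank ℝ (otherSpan X) ≤ Module.finrank ℝ (coordKer d) :=
    Submodule.finrank_map_le _ _
  have h3 := finrank_coordKer (d := d)
  rw [finrank_euclideanSpace, Fintype.card_fin] at h1
  omega

/-- Changing the coefficients of the other columns only adds an element of `otherSpan X`. This
allows the residual direction to be used in place of the first basis vector. -/
theorem firstResidual_eq_starProjection (X : Fin n → EuclideanSpace ℝ (Fin d))
    {c : EuclideanSpace ℝ (Fin d)} (hc : c 0 = 1) :
    firstResidual X = (otherSpan X)ᗮ.starProjection (design X c) := by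
  have hmem : design X (c - EuclideanSpace.single 0 1) ∈ otherSpan X :=
    Submodule.mem_map_of_mem (by simp [hc])
  rw [firstResidual, ← starProjection_orthogonal_add _ hmem, map_sub]
  congr 1
  abel

theorem norm_firstResidual_sq_le (X : Fin n → EuclideanSpace ℝ (Fin d))
    {c : EuclideanSpace ℝ (Fin d)} (hc : c 0 = 1) :
    ‖firstResidual X‖ ^ 2 ≤ ∑ j, (inner ℝ (X j) c) ^ 2 := by
  have h : ∑ j, (inner ℝ (X j) c) ^ 2 = ‖design X c‖ ^ 2 := by
    rw [EuclideanSpace.real_norm_sq_eq]; simp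
  rw [h, firstResidual_eq_starProjection X hc]
  gcongr
  exact Submodule.norm_starProjection_apply_le _ _

theorem norm_firstResidual_sq_of_eq_one (hd : d = 1) (X : Fin n → EuclideanSpace ℝ (Fin d))
    {c : EuclideanSpace ℝ (Fin d)} (hc : c 0 = 1) :
    ‖firstResidual X‖ ^ 2 = ∑ j, (inner ℝ (X j) c) ^ 2 := by
  have h : ∑ j, (inner ℝ (X j) c) ^ 2 = ‖design X c‖ ^ 2 := by
    rw [EuclideanSpace.real_norm_sq_eq]; simp
  have hW : otherSpan X = ⊥ := by
    have h0 := finrank_coordKer (d := d)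
    rw [otherSpan, Submodule.finrank_eq_zero.1 (show Module.finrank ℝ (coordKer d) = 0 by omega),
      Submodule.map_bot]
  rw [h, firstResidual_eq_starProjection X hc, starProjection_orthogonal_congr hW,
    Submodule.starProjection_orthogonal_val]
  simp

/-- The perturbation `r` enters the first column only, so the space projected onto is fixed once `Z`
is. -/
theorem firstResidual_add_smul_single (Z : Fin n → EuclideanSpace ℝ (Fin d)) (r : Fin n → ℝ) :
    firstResidual (fun j => Z j + r j • EuclideanSpace.single 0 (1 : ℝ)) =
      (otherSpan Z)ᗮ.starProjection (design Z (EuclideanSpace.single 0 1) + toLp 2 r) := by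
  have hd : ∀ θ, design (fun j => Z j + r j • EuclideanSpace.single 0 (1 : ℝ)) θ =
      design Z θ + θ 0 • toLp 2 r := fun θ => by
    ext j
    simp [inner_add_left, real_inner_smul_left, EuclideanSpace.inner_single_left, mul_comm]
  have hW : otherSpan (fun j => Z j + r j • EuclideanSpace.single 0 (1 : ℝ)) = otherSpan Z := by
    ext x
    simp only [otherSpan, Submodule.mem_map, mem_coordKer]
    refine exists_congr fun θ => and_congr_right fun hθ => ?_
    rw [hd, hθ, zero_smul, add_zero]
  rw [firstResidual, starProjection_orthogonal_congr hW, hd]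
  simp

end Design

/-! ### Exact formulas for the minimum losses. -/

section Regression

variable {d n : ℕ} (Sig : Matrix (Fin d) (Fin d) ℝ) (s : ℝ) (θstar : EuclideanSpace ℝ (Fin d))

/-- The covariates of a dataset, an absent example having covariate `0`. -/
def covariates (S : Fin n → Option (EuclideanSpace ℝ (Fin d) × ℝ)) (j : Fin n) :
    EuclideanSpace ℝ (Fin d) := ((S j).getD 0).1

/-- The responses of a dataset, an absent example having response `0`. -/
noncomputable def responses (S : Fin n → Option (EuclideanSpace ℝ (Fin d) × ℝ)) :
    EuclideanSpace ℝ (Fin n) := toLp 2 fun j => ((S j).getD 0).2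

theorem empLoss_regressionTask (S : Fin n → Option (EuclideanSpace ℝ (Fin d) × ℝ))
    (θ : EuclideanSpace ℝ (Fin d)) :
    (regressionTask Sig s θstar).empLoss θ S =
      1 / n * ‖design (covariates S) θ - responses S‖ ^ 2 := by
  rw [LearningTask.empLoss, EuclideanSpace.real_norm_sq_eq]
  congr 1
  refine Finset.sum_congr rfl fun j _ => ?_
  rcases h : S j with _ | z
  · simp [LearningTask.lossBot, covariates, responses, h]
  · simp [LearningTask.lossBot, covariates, responses, h, regressionTask]

theorem isLeast_empLoss_regressionTask (S : Fin n → Option (EuclideanSpace ℝ (Fin d) × ℝ)) :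
    IsLeast {v | ∃ θ ∈ (regressionTask Sig s θstar).params,
        v = (regressionTask Sig s θstar).empLoss θ S}
      (1 / n * ‖(LinearMap.range (design (covariates S)))ᗮ.starProjection (responses S)‖ ^ 2) := by
  have h := isLeast_norm_sub_sq (design (covariates S)) ⊤ 0 (responses S)
  simp only [Submodule.mem_top, true_and, Submodule.map_top, map_zero, zero_sub, map_neg,
    norm_neg] at h
  obtain ⟨⟨θ, hθ⟩, h2⟩ := h
  refine ⟨⟨θ, Set.mem_univ _, by rw [empLoss_regressionTask, hθ]⟩, ?_⟩
  rintro _ ⟨θ', -, rfl⟩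
  rw [empLoss_regressionTask]
  refine mul_le_mul_of_nonneg_left ?_ (by positivity)
  exact h2 ⟨θ', rfl⟩

theorem minLoss_regressionTask (S : Fin n → Option (EuclideanSpace ℝ (Fin d) × ℝ)) :
    (regressionTask Sig s θstar).minLoss S =
      1 / n * ‖(LinearMap.range (design (covariates S)))ᗮ.starProjection (responses S)‖ ^ 2 :=
  (isLeast_empLoss_regressionTask Sig s θstar S).csInf_eq

theorem exists_isEmpMinimizer_regressionTask
    (S : Fin n → Option (EuclideanSpace ℝ (Fin d) × ℝ)) :
    ∃ θ, (regressionTask Sig s θstar).IsEmpMinimizer S θ := by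
  obtain ⟨⟨θ, hθ, h1⟩, h2⟩ := isLeast_empLoss_regressionTask Sig s θstar S
  exact ⟨θ, hθ, fun θ' hθ' => h1 ▸ h2 ⟨θ', hθ', rfl⟩⟩

theorem minLoss_le_empLoss (S : Fin n → Option (EuclideanSpace ℝ (Fin d) × ℝ))
    (θ : EuclideanSpace ℝ (Fin d)) :
    (regressionTask Sig s θstar).minLoss S ≤ (regressionTask Sig s θstar).empLoss θ S := by
  rw [minLoss_regressionTask]
  exact (isLeast_empLoss_regressionTask Sig s θstar S).2 ⟨θ, Set.mem_univ _, rfl⟩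

theorem LearningTask.IsEmpMinimizer.minLoss_eq_empLoss
    {S : Fin n → Option (EuclideanSpace ℝ (Fin d) × ℝ)} {θ : EuclideanSpace ℝ (Fin d)}
    (hθ : (regressionTask Sig s θstar).IsEmpMinimizer S θ) :
    (regressionTask Sig s θstar).minLoss S = (regressionTask Sig s θstar).empLoss θ S := by
  refine IsLeast.csInf_eq ⟨⟨θ, hθ.1, rfl⟩, ?_⟩
  rintro _ ⟨θ', h', rfl⟩
  exact hθ.2 θ' h'

/-- The dataset with covariates `X` and noise `η`. -/
noncomputable def noisyData (X : Fin n → EuclideanSpace ℝ (Fin d)) (η : Fin n → ℝ) :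
    Fin n → EuclideanSpace ℝ (Fin d) × ℝ :=
  fun j => (X j, inner ℝ (X j) θstar + η j)

theorem covariates_full (Z : Fin n → EuclideanSpace ℝ (Fin d) × ℝ) :
    covariates (LearningTask.full Z) = fun j => (Z j).1 := rfl

theorem responses_full_noisyData (X : Fin n → EuclideanSpace ℝ (Fin d)) (η : Fin n → ℝ) :
    responses (LearningTask.full (noisyData θstar X η)) = design X θstar + toLp 2 η := by
  ext j
  simp [responses, LearningTask.full, noisyData]

theorem norm_add_smul_single_sq (u : EuclideanSpace ℝ (Fin n)) (i : Fin n) (c : ℝ) :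
    ‖u + c • EuclideanSpace.single i (1 : ℝ)‖ ^ 2 =
      (u i + c) ^ 2 + ∑ j ∈ Finset.univ.erase i, u j ^ 2 := by
  rw [EuclideanSpace.real_norm_sq_eq, ← Finset.add_sum_erase _ _ (Finset.mem_univ i)]
  congr 1
  · simp
  · refine Finset.sum_congr rfl fun j hj => ?_
    simp [Finset.ne_of_mem_erase hj]

theorem empLoss_leaveOut_noisyData (X : Fin n → EuclideanSpace ℝ (Fin d)) (η : Fin n → ℝ)
    (i : Fin n) (θ : EuclideanSpace ℝ (Fin d)) :
    (regressionTask Sig s θstar).empLoss θ (LearningTask.leaveOut (noisyData θstar X η) i) =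
      1 / n * ∑ j ∈ Finset.univ.erase i,
        ((design X θ - (design X θstar + toLp 2 η)) j) ^ 2 := by
  rw [LearningTask.empLoss]
  congr 1
  rw [← Finset.add_sum_erase _ _ (Finset.mem_univ i)]
  have hi : (regressionTask Sig s θstar).lossBot θ
      (LearningTask.leaveOut (noisyData θstar X η) i i) = 0 := by
    simp [LearningTask.leaveOut, LearningTask.lossBot]
  rw [hi, zero_add]
  refine Finset.sum_congr rfl fun j hj => ?_
  simp [LearningTask.leaveOut, Finset.ne_of_mem_erase hj, LearningTask.lossBot,
    LearningTask.full, regressionTask, noisyData]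

/-- Ignoring example `i` is the same as fitting it perfectly with an extra column e_i. Since `f` is
orthogonal to the range of the design, the signal drops out and only the noise remains. -/
theorem exists_abs_minLoss_sub_minLoss_leaveOut_eq_inner_sq
    (X : Fin n → EuclideanSpace ℝ (Fin d)) (i : Fin n) :
    ∃ f : EuclideanSpace ℝ (Fin n), ‖f‖ ≤ 1 ∧ ∀ η : Fin n → ℝ,
      |(regressionTask Sig s θstar).minLoss (LearningTask.full (noisyData θstar X η)) -
        (regressionTask Sig s θstar).minLoss
          (LearningTask.leaveOut (noisyData θstar X η) i)| =
        1 / n * (inner ℝ f (toLp 2 η)) ^ 2 := by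
  obtain ⟨f, hfK, hf, hleast⟩ := exists_isLeast_norm_starProjection_smul_sub_sq
    (LinearMap.range (design X))ᗮ (EuclideanSpace.single i (1 : ℝ))
  refine ⟨f, hf, fun η => ?_⟩
  set y := design X θstar + toLp 2 η with hy
  have hfy : inner ℝ f y = inner ℝ f (toLp 2 η) := by
    rw [hy, inner_add_right, Submodule.inner_left_of_mem_orthogonal
      (LinearMap.mem_range_self (design X) θstar) hfK, zero_add]
  set S := LearningTask.leaveOut (noisyData θstar X η) i
  have hQ : ∀ (θ : EuclideanSpace ℝ (Fin d)) (c : ℝ),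
      ‖(LinearMap.range (design X))ᗮ.starProjection (c • EuclideanSpace.single i (1 : ℝ) - y)‖ ^ 2 ≤
        ‖design X θ - y + c • EuclideanSpace.single i (1 : ℝ)‖ ^ 2 := fun θ c => by
    rw [← starProjection_orthogonal_add _ (LinearMap.mem_range_self (design X) θ),
      show design X θ - y + c • EuclideanSpace.single i (1 : ℝ) =
        c • EuclideanSpace.single i (1 : ℝ) - y + design X θ by abel]
    gcongr
    exact Submodule.norm_starProjection_apply_le _ _
  have hL : (regressionTask Sig s θstar).minLoss S = 1 / n *
      (‖(LinearMap.range (design X))ᗮ.starProjection y‖ ^ 2 - (inner ℝ f y) ^ 2) := by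
    obtain ⟨⟨c, hc⟩, hmin⟩ := hleast y
    refine le_antisymm ?_ ?_
    · obtain ⟨⟨θ, -, hθ⟩, -⟩ := isLeast_norm_sub_sq (design X) ⊤ 0
        (y - c • EuclideanSpace.single i (1 : ℝ))
      rw [map_zero, zero_sub, neg_sub,
        starProjection_orthogonal_congr (Submodule.map_top (design X))] at hθ
      refine (minLoss_le_empLoss Sig s θstar S θ).trans ?_
      rw [empLoss_leaveOut_noisyData, ← hc]
      simp only
      rw [hθ, ← sub_add, norm_add_smul_single_sq]
      gcongr
      exact le_add_of_nonneg_left (sq_nonneg _)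
    · obtain ⟨θ, hθ⟩ := exists_isEmpMinimizer_regressionTask Sig s θstar S
      rw [hθ.minLoss_eq_empLoss, empLoss_leaveOut_noisyData]
      gcongr
      -- The coefficient of e_i that cancels the `i`-th residual.
      refine (hmin ⟨-((design X θ - y) i), rfl⟩).trans ((hQ θ _).trans (le_of_eq ?_))
      rw [norm_add_smul_single_sq, hy]
      simp
  rw [hL, minLoss_regressionTask, responses_full_noisyData, hfy, ← mul_sub]
  have : covariates (LearningTask.full (noisyData θstar X η)) = X := rfl
  rw [starProjection_orthogonal_congr (congrArg (fun X => LinearMap.range (design X)) this),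
    sub_sub_cancel, abs_of_nonneg (by positivity)]

theorem minLoss_noisyData_le (X : Fin n → EuclideanSpace ℝ (Fin d)) (η : Fin n → ℝ) :
    (regressionTask Sig s θstar).minLoss (LearningTask.full (noisyData θstar X η)) ≤
      1 / n * ∑ j, η j ^ 2 := by
  refine (minLoss_le_empLoss Sig s θstar _ θstar).trans (le_of_eq ?_)
  simp [LearningTask.empLoss, LearningTask.full, LearningTask.lossBot, noisyData, regressionTask]

variable [NeZero d]

theorem isLeast_empLossAt_regressionTask (w : ℝ)
    (S : Fin n → Option (EuclideanSpace ℝ (Fin d) × ℝ)) :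
    IsLeast {v | ∃ θ ∈ (regressionTask Sig s θstar).params, θ 0 = w ∧
        v = (regressionTask Sig s θstar).empLoss θ S}
      (1 / n * ‖(otherSpan (covariates S))ᗮ.starProjection
        (w • design (covariates S) (EuclideanSpace.single 0 1) - responses S)‖ ^ 2) := by
  have h := isLeast_norm_sub_sq (design (covariates S)) (coordKer d)
    (w • EuclideanSpace.single 0 1) (responses S)
  have hm : ∀ θ : EuclideanSpace ℝ (Fin d),
      θ - w • EuclideanSpace.single 0 1 ∈ coordKer d ↔ θ 0 = w := fun θ => by
    simp [sub_eq_zero]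
  simp only [hm, map_smul] at h
  obtain ⟨⟨θ, hw, hθ⟩, h2⟩ := h
  refine ⟨⟨θ, Set.mem_univ _, hw, by rw [empLoss_regressionTask, ← hθ, otherSpan]⟩, ?_⟩
  rintro _ ⟨θ', -, hw', rfl⟩
  rw [empLoss_regressionTask]
  refine mul_le_mul_of_nonneg_left ?_ (by positivity)
  exact h2 ⟨θ', hw', rfl⟩

theorem minLossAt_regressionTask (w : ℝ) (S : Fin n → Option (EuclideanSpace ℝ (Fin d) × ℝ)) :
    (regressionTask Sig s θstar).minLossAt w S = 1 / n * ‖(otherSpan (covariates S))ᗮ.starProjection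
      (w • design (covariates S) (EuclideanSpace.single 0 1) - responses S)‖ ^ 2 :=
  (isLeast_empLossAt_regressionTask Sig s θstar w S).csInf_eq

theorem minLoss_le_minLossAt (w : ℝ) (S : Fin n → Option (EuclideanSpace ℝ (Fin d) × ℝ)) :
    (regressionTask Sig s θstar).minLoss S ≤ (regressionTask Sig s θstar).minLossAt w S := by
  obtain ⟨⟨θ, hθ, -, h⟩, -⟩ := isLeast_empLossAt_regressionTask Sig s θstar w S
  rw [minLossAt_regressionTask, h, minLoss_regressionTask]
  exact (isLeast_empLoss_regressionTask Sig s θstar S).2 ⟨θ, hθ, rfl⟩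

theorem LearningTask.IsEmpMinimizer.minLossAt_eq_minLoss
    {S : Fin n → Option (EuclideanSpace ℝ (Fin d) × ℝ)} {θ : EuclideanSpace ℝ (Fin d)}
    (hθ : (regressionTask Sig s θstar).IsEmpMinimizer S θ) :
    (regressionTask Sig s θstar).minLossAt (θ 0) S = (regressionTask Sig s θstar).minLoss S := by
  refine le_antisymm ?_ (minLoss_le_minLossAt Sig s θstar _ S)
  rw [hθ.minLoss_eq_empLoss, minLossAt_regressionTask]
  exact (isLeast_empLossAt_regressionTask Sig s θstar (θ 0) S).2 ⟨θ, hθ.1, rfl, rfl⟩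

theorem LearningTask.IsEmpMinimizer.minLossAt_sub_minLoss
    {S : Fin n → Option (EuclideanSpace ℝ (Fin d) × ℝ)} {θ : EuclideanSpace ℝ (Fin d)}
    (hθ : (regressionTask Sig s θstar).IsEmpMinimizer S θ) (w : ℝ) :
    (regressionTask Sig s θstar).minLossAt w S - (regressionTask Sig s θstar).minLoss S =
      1 / n * ‖firstResidual (covariates S)‖ ^ 2 * (w - θ 0) ^ 2 := by
  rcases Nat.eq_zero_or_pos n with rfl | hn
  · simp [minLossAt_regressionTask, minLoss_regressionTask]
  have hn' : (0 : ℝ) < 1 / n := by positivity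
  have h := norm_starProjection_smul_sub_sq_sub_of_forall_le (otherSpan (covariates S))ᗮ
    (design (covariates S) (EuclideanSpace.single 0 1)) (responses S) (w₀ := θ 0) fun w' => by
      rw [← mul_le_mul_iff_right₀ hn', ← minLossAt_regressionTask Sig s θstar,
        ← minLossAt_regressionTask Sig s θstar, hθ.minLossAt_eq_minLoss]
      exact minLoss_le_minLossAt Sig s θstar w' S
  rw [← hθ.minLossAt_eq_minLoss, minLossAt_regressionTask, minLossAt_regressionTask, ← mul_sub,
    h w, mul_assoc]
  rfl

/-- Modulo `otherSpan X`, the signal is `θstar 0` times the first column. Constraining at `θstar 0`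
thus leaves pure noise, and freeing the coordinate adds one regressor. -/
theorem exists_minLossAt_sub_minLoss_eq_inner_sq (X : Fin n → EuclideanSpace ℝ (Fin d)) :
    ∃ f : EuclideanSpace ℝ (Fin n), ‖f‖ ≤ 1 ∧ ∀ η : Fin n → ℝ,
      (regressionTask Sig s θstar).minLossAt (θstar 0) (LearningTask.full (noisyData θstar X η)) -
        (regressionTask Sig s θstar).minLoss (LearningTask.full (noisyData θstar X η)) =
        1 / n * (inner ℝ f (toLp 2 η)) ^ 2 := by
  obtain ⟨f, -, hf, hleast⟩ := exists_isLeast_norm_starProjection_smul_sub_sq (otherSpan X)ᗮ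
    (design X (EuclideanSpace.single 0 1))
  refine ⟨f, hf, fun η => ?_⟩
  set S := LearningTask.full (noisyData θstar X η)
  have hat : ∀ w, (regressionTask Sig s θstar).minLossAt w S =
      1 / n * ‖(otherSpan X)ᗮ.starProjection ((w - θstar 0) • design X (EuclideanSpace.single 0 1) - toLp 2 η)‖ ^ 2 := fun w => by
    rw [minLossAt_regressionTask, responses_full_noisyData]
    have hmem : design X (θstar - θstar 0 • EuclideanSpace.single 0 1) ∈ otherSpan X :=
      Submodule.mem_map_of_mem (by simp)
    rw [← starProjection_orthogonal_add (covariates S |> otherSpan) hmem]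
    congr 4
    change _ • design X _ - _ + _ = _
    rw [map_sub, map_smul, sub_smul]
    abel
  obtain ⟨θ, hθ⟩ := exists_isEmpMinimizer_regressionTask Sig s θstar S
  obtain ⟨⟨c, hc⟩, hmin⟩ := hleast (toLp 2 η)
  have h1 : (regressionTask Sig s θstar).minLoss S =
      1 / n * (‖(otherSpan X)ᗮ.starProjection (toLp 2 η)‖ ^ 2 - (inner ℝ f (toLp 2 η)) ^ 2) := by
    refine le_antisymm ?_ ?_
    · rw [← hc]
      refine (minLoss_le_minLossAt Sig s θstar (θstar 0 + c) S).trans (le_of_eq ?_)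
      rw [hat]
      simp
    · rw [← hθ.minLossAt_eq_minLoss, hat]
      gcongr
      exact hmin ⟨_, rfl⟩
  rw [h1, hat, sub_self, zero_smul, zero_sub, map_neg, norm_neg]
  ring

end Regression

/-! ### Measurability, and conditioning on the covariates. -/

theorem measurable_sInf_of_continuous {X ι : Type*} [TopologicalSpace X] [MeasurableSpace X]
    [OpensMeasurableSpace X] (p : ι → Prop) {f : ι → X → ℝ} (hf : ∀ i, Continuous (f i))
    (h0 : ∀ i x, 0 ≤ f i x) : Measurable fun x => sInf {v | ∃ i, p i ∧ v = f i x} := by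
  have h : (fun x => sInf {v | ∃ i, p i ∧ v = f i x}) = fun x => ⨅ i : {i // p i}, f i x := by
    ext x
    rw [iInf]
    congr 1
    ext v
    simp [eq_comm]
  rw [h]
  refine (upperSemicontinuous_ciInf (f := fun (i : {i // p i}) x => f i x) (fun x => ⟨0, ?_⟩)
    fun i => (hf i).upperSemicontinuous).measurable
  rintro _ ⟨i, rfl⟩
  exact h0 i x

section Regression

variable {d n : ℕ} (Sig : Matrix (Fin d) (Fin d) ℝ) (s : ℝ) (θstar : EuclideanSpace ℝ (Fin d))

theorem continuous_empLoss_full (θ : EuclideanSpace ℝ (Fin d)) :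
    Continuous fun Z : Fin n → EuclideanSpace ℝ (Fin d) × ℝ =>
      (regressionTask Sig s θstar).empLoss θ (LearningTask.full Z) := by
  simp only [LearningTask.empLoss, LearningTask.full, LearningTask.lossBot, regressionTask]
  fun_prop

theorem continuous_empLoss_leaveOut (θ : EuclideanSpace ℝ (Fin d)) (i : Fin n) :
    Continuous fun Z : Fin n → EuclideanSpace ℝ (Fin d) × ℝ =>
      (regressionTask Sig s θstar).empLoss θ (LearningTask.leaveOut Z i) := by
  refine continuous_const.mul (continuous_finsetSum _ fun j _ => ?_)
  by_cases h : j = i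
  · subst h
    simpa [LearningTask.leaveOut, LearningTask.lossBot] using continuous_const
  · simp only [LearningTask.leaveOut, Function.update_of_ne h, LearningTask.full,
      LearningTask.lossBot, regressionTask]
    fun_prop

theorem empLoss_regressionTask_nonneg (θ : EuclideanSpace ℝ (Fin d))
    (S : Fin n → Option (EuclideanSpace ℝ (Fin d) × ℝ)) :
    0 ≤ (regressionTask Sig s θstar).empLoss θ S := by
  rw [empLoss_regressionTask]
  positivity

theorem measurable_minLoss_full :
    Measurable fun Z : Fin n → EuclideanSpace ℝ (Fin d) × ℝ =>
      (regressionTask Sig s θstar).minLoss (LearningTask.full Z) :=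
  measurable_sInf_of_continuous _ (continuous_empLoss_full Sig s θstar)
    fun _ _ => empLoss_regressionTask_nonneg Sig s θstar _ _

theorem measurable_minLoss_leaveOut (i : Fin n) :
    Measurable fun Z : Fin n → EuclideanSpace ℝ (Fin d) × ℝ =>
      (regressionTask Sig s θstar).minLoss (LearningTask.leaveOut Z i) :=
  measurable_sInf_of_continuous _ (fun θ => continuous_empLoss_leaveOut Sig s θstar θ i)
    fun _ _ => empLoss_regressionTask_nonneg Sig s θstar _ _

theorem measurable_minLossAt_full [NeZero d] (w : ℝ) :
    Measurable fun Z : Fin n → EuclideanSpace ℝ (Fin d) × ℝ =>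
      (regressionTask Sig s θstar).minLossAt w (LearningTask.full Z) := by
  have h := measurable_sInf_of_continuous
    (fun θ => θ ∈ (regressionTask Sig s θstar).params ∧ θ 0 = w)
    (continuous_empLoss_full (n := n) Sig s θstar)
    fun _ _ => empLoss_regressionTask_nonneg Sig s θstar _ _
  simpa only [LearningTask.minLossAt, and_assoc] using h

/-- ‖q‖² is the constrained minimum at w = 1 with zero responses, hence an infimum of continuous
functions. The loss ignores the task's other data, so zeros serve for them. -/
theorem measurable_norm_firstResidual_sq [NeZero d] :
    Measurable fun X : Fin n → EuclideanSpace ℝ (Fin d) => ‖firstResidual X‖ ^ 2 := by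
  rcases Nat.eq_zero_or_pos n with rfl | hn
  · simp [Subsingleton.elim (firstResidual _) 0]
  have h : (fun X : Fin n → EuclideanSpace ℝ (Fin d) => ‖firstResidual X‖ ^ 2) = fun X =>
      n * (regressionTask 0 0 0).minLossAt 1 (LearningTask.full fun j => (X j, (0 : ℝ))) := by
    ext X
    rw [minLossAt_regressionTask]
    have h0 : responses (LearningTask.full fun j => (X j, (0 : ℝ))) = 0 := by
      ext j
      simp [responses, LearningTask.full]
    rw [h0, one_smul, sub_zero]
    field_simp
    rfl
  rw [h]
  exact ((measurable_minLossAt_full 0 0 0 1).comp (by fun_prop)).const_mul _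

theorem measurable_norm_firstResidual_sq_comp [NeZero d] {Y : Type*} [MeasurableSpace Y]
    {g : Y → Fin n → EuclideanSpace ℝ (Fin d)} (hg : Measurable g) :
    Measurable fun y => ‖firstResidual (g y)‖ ^ 2 :=
  measurable_norm_firstResidual_sq.comp hg

theorem sampleLaw_regressionTask_le {A : Set (Fin n → EuclideanSpace ℝ (Fin d) × ℝ)}
    (hA : MeasurableSet A) {g : (Fin n → EuclideanSpace ℝ (Fin d)) → ℝ≥0∞}
    (h : ∀ X, Measure.pi (fun _ : Fin n => gaussianReal 0 (Real.toNNReal (s ^ 2)))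
      {η | noisyData θstar X η ∈ A} ≤ g X) :
    (regressionTask Sig s θstar).sampleLaw n A ≤
      ∫⁻ X, g X ∂Measure.pi fun _ : Fin n => multivariateGaussian 0 Sig := by
  have hm : Measurable fun p : (Fin n → EuclideanSpace ℝ (Fin d)) × (Fin n → ℝ) =>
      fun j => (p.1 j, inner ℝ (p.1 j) θstar + p.2 j) := by fun_prop
  rw [sampleLaw_regressionTask, Measure.map_apply hm hA, Measure.prod_apply (hm hA)]
  exact lintegral_mono h

theorem sampleLaw_regressionTask_le_const {A : Set (Fin n → EuclideanSpace ℝ (Fin d) × ℝ)}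
    (hA : MeasurableSet A) {b : ℝ≥0∞}
    (h : ∀ X, Measure.pi (fun _ : Fin n => gaussianReal 0 (Real.toNNReal (s ^ 2)))
      {η | noisyData θstar X η ∈ A} ≤ b) :
    (regressionTask Sig s θstar).sampleLaw n A ≤ b :=
  (sampleLaw_regressionTask_le Sig s θstar hA h).trans (by simp)

theorem map_fst_sampleLaw_regressionTask :
    ((regressionTask Sig s θstar).sampleLaw n).map (fun Z j => (Z j).1) =
      Measure.pi fun _ : Fin n => multivariateGaussian 0 Sig := by
  rw [sampleLaw_regressionTask, Measure.map_map (by fun_prop) (by fun_prop)]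
  change Measure.map Prod.fst _ = _
  rw [Measure.map_fst_prod]
  simp

instance isProbabilityMeasure_sampleLaw_regressionTask :
    IsProbabilityMeasure ((regressionTask Sig s θstar).sampleLaw n) := by
  have := (regressionTask Sig s θstar).isProbabilityMeasure_dist
  rw [LearningTask.sampleLaw]
  infer_instance

theorem inv_sqrt_pow_eq_exp {w : ℝ} (hw : 0 < w) (m : ℕ) :
    (Real.sqrt w)⁻¹ ^ m = Real.exp (-(m / 2 * Real.log w)) := by
  rw [← Real.exp_log (inv_pos.2 (Real.sqrt_pos.2 hw)), ← Real.exp_nat_mul, Real.log_inv,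
    Real.log_sqrt hw.le]
  congr 1
  ring

/-! ### The Laplace transform of the squared first residual. -/

variable {Sig}

theorem lintegral_pi_multivariateGaussian (hSig : Sig.PosDef) (i : Fin d)
    {g : (Fin n → EuclideanSpace ℝ (Fin d)) → ℝ≥0∞} (hg : Measurable g) :
    ∫⁻ X, g X ∂Measure.pi (fun _ : Fin n => multivariateGaussian 0 Sig) =
      ∫⁻ Z, ∫⁻ r, g (fun j => Z j + r j • EuclideanSpace.single i (1 : ℝ))
        ∂Measure.pi (fun _ : Fin n => gaussianReal 0 (Real.toNNReal (1 / Sig⁻¹ i i)))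
        ∂Measure.pi fun _ : Fin n =>
          multivariateGaussian 0 (Sig - Matrix.single i i (1 / Sig⁻¹ i i)) := by
  have hf : Measurable fun p : (Fin n → EuclideanSpace ℝ (Fin d)) × (Fin n → ℝ) =>
      fun j => p.1 j + p.2 j • EuclideanSpace.single i (1 : ℝ) := by fun_prop
  rw [pi_multivariateGaussian_eq_map n hSig i, lintegral_map hg hf]
  exact lintegral_prod _ (hg.comp hf).aemeasurable

theorem lintegral_pi_gaussianReal_exp_neg_mul_norm_firstResidual_sq_le [NeZero d]
    (Z : Fin n → EuclideanSpace ℝ (Fin d)) {v : ℝ≥0} (hv : v ≠ 0) {t : ℝ} (ht : 0 ≤ t) :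
    ∫⁻ r, ENNReal.ofReal (Real.exp (-(t *
        ‖firstResidual fun j => Z j + r j • EuclideanSpace.single (0 : Fin d) (1 : ℝ)‖ ^ 2)))
        ∂Measure.pi (fun _ : Fin n => gaussianReal 0 v) ≤
      ENNReal.ofReal ((Real.sqrt (1 + 2 * t * v))⁻¹ ^ (n + 1 - d)) := by
  have hw : 1 ≤ Real.sqrt (1 + 2 * t * v) := by
    rw [Real.one_le_sqrt]
    have : 0 ≤ 2 * t * v := by positivity
    linarith
  simp only [firstResidual_add_smul_single]
  refine (lintegral_exp_neg_mul_norm_starProjection_sq_le hv ht _ _).trans ?_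
  refine ENNReal.ofReal_le_ofReal (pow_le_pow_of_le_one (by positivity)
    (inv_le_one_of_one_le₀ hw) ?_)
  have := le_finrank_otherSpan_orthogonal Z
  omega

theorem lintegral_exp_neg_mul_norm_firstResidual_sq_le [NeZero d] (hSig : Sig.PosDef) {t : ℝ}
    (ht : 0 ≤ t) :
    ∫⁻ X, ENNReal.ofReal (Real.exp (-(t * ‖firstResidual X‖ ^ 2)))
        ∂Measure.pi (fun _ : Fin n => multivariateGaussian 0 Sig) ≤
      ENNReal.ofReal ((Real.sqrt (1 + 2 * t * (1 / Sig⁻¹ 0 0)))⁻¹ ^ (n + 1 - d)) := by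
  have hm := inv_diag_pos hSig 0
  have hq : Measurable fun X : Fin n → EuclideanSpace ℝ (Fin d) =>
      ENNReal.ofReal (Real.exp (-(t * ‖firstResidual X‖ ^ 2))) :=
    (measurable_norm_firstResidual_sq.const_mul t).neg.exp.ennreal_ofReal
  have h := lintegral_mono (μ := Measure.pi fun _ : Fin n =>
    multivariateGaussian 0 (Sig - Matrix.single 0 0 (1 / Sig⁻¹ 0 0))) fun Z =>
      lintegral_pi_gaussianReal_exp_neg_mul_norm_firstResidual_sq_le Z
        (v := Real.toNNReal (1 / Sig⁻¹ 0 0)) (by simpa using hm) ht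
  rw [lintegral_const, measure_univ, mul_one, Real.coe_toNNReal _ hm.le] at h
  exact (lintegral_pi_multivariateGaussian hSig 0 hq).le.trans h

end Regression

/-! ### Tail bounds for the sample. -/

theorem pi_gaussianReal_mul_le_sum_sq_le {ι : Type*} [Fintype ι] {v : ℝ≥0} (hv : v ≠ 0) (T : ℝ) :
    Measure.pi (fun _ : ι => gaussianReal 0 v) {x | T * v ≤ ∑ i, x i ^ 2} ≤
      ENNReal.ofReal (Real.exp (Fintype.card ι / 2 * Real.log 2 - T / 4)) := by
  have hv' : (0 : ℝ) < v := by positivity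
  have h2 : 2 * (1 / (4 * (v : ℝ))) * v = 1 / 2 := by field_simp; norm_num
  refine (pi_gaussianReal_le_sum_sq_le hv (u := 1 / (4 * v)) (by positivity)
    (by rw [h2]; norm_num) _).trans (ENNReal.ofReal_le_ofReal (le_of_eq ?_))
  rw [h2, inv_sqrt_pow_eq_exp (by norm_num), ← Real.exp_add,
    show (1 : ℝ) - 1 / 2 = 2⁻¹ by norm_num, Real.log_inv]
  congr 1
  field_simp
  ring

section Regression

variable {d n : ℕ} {Sig : Matrix (Fin d) (Fin d) ℝ} {s : ℝ} (θstar : EuclideanSpace ℝ (Fin d))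

theorem sampleLaw_le_minLoss_le (hs : 0 < s) {β : ℝ} (hβ : 0 < β) (hn : 0 < n) :
    (regressionTask Sig s θstar).sampleLaw n
      {Z | (2 * s) ^ 2 * (1 + Real.log (1 / β) / n) ≤
        (regressionTask Sig s θstar).minLoss (LearningTask.full Z)} ≤ ENNReal.ofReal β := by
  refine sampleLaw_regressionTask_le_const Sig s θstar
    (measurableSet_le measurable_const (measurable_minLoss_full Sig s θstar)) fun X => ?_
  have hs2 : 0 < s ^ 2 := by positivity
  have hn' : (0 : ℝ) < n := by exact_mod_cast hn
  have h := pi_gaussianReal_mul_le_sum_sq_le (ι := Fin n) (v := (s ^ 2).toNNReal)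
    (by simpa using hs.ne') (4 * (n + Real.log (1 / β)))
  rw [Real.coe_toNNReal _ hs2.le, Fintype.card_fin] at h
  refine (measure_mono fun η hη => ?_).trans (h.trans (ENNReal.ofReal_le_ofReal ?_))
  · have h1 : (2 * s) ^ 2 * (1 + Real.log (1 / β) / n) ≤ 1 / n * ∑ j, η j ^ 2 :=
      le_trans hη (minLoss_noisyData_le Sig s θstar X η)
    have h2 := mul_le_mul_of_nonneg_left h1 hn'.le
    have e1 : (n : ℝ) * (1 / n * ∑ j, η j ^ 2) = ∑ j, η j ^ 2 := by field_simp
    have e2 : (n : ℝ) * ((2 * s) ^ 2 * (1 + Real.log (1 / β) / n)) =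
        4 * (n + Real.log (1 / β)) * s ^ 2 := by field_simp; ring
    rw [e1, e2] at h2
    exact h2
  · rw [← Real.le_log_iff_exp_le hβ, one_div, Real.log_inv]
    have := Real.log_two_lt_d9
    nlinarith

theorem sampleLaw_le_abs_minLoss_sub_minLoss_leaveOut_le (hs : 0 < s) {β : ℝ} (hβ : 0 < β)
    (i : Fin n) :
    (regressionTask Sig s θstar).sampleLaw n
      {Z | 2 * s ^ 2 * Real.log (2 / β) / n ≤
        |(regressionTask Sig s θstar).minLoss (LearningTask.full Z) -
          (regressionTask Sig s θstar).minLoss (LearningTask.leaveOut Z i)|} ≤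
      ENNReal.ofReal β := by
  rcases le_or_gt 1 β with h1 | h1
  · exact prob_le_one.trans (by simpa using h1)
  refine sampleLaw_regressionTask_le_const Sig s θstar (measurableSet_le measurable_const
    ((measurable_minLoss_full Sig s θstar).sub
      (measurable_minLoss_leaveOut Sig s θstar i)).norm) fun X => ?_
  have hs2 : 0 < s ^ 2 := by positivity
  have hn' : (0 : ℝ) < n := by exact_mod_cast i.pos
  have hlog : 0 ≤ Real.log (2 / β) := Real.log_nonneg (by rw [le_div_iff₀ hβ]; linarith)
  obtain ⟨f, hf, hfη⟩ := exists_abs_minLoss_sub_minLoss_leaveOut_eq_inner_sq Sig s θstar X i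
  have h := pi_gaussianReal_le_inner_sq_le (s ^ 2).toNNReal hf
    (t := 2 * s ^ 2 * Real.log (2 / β)) (by positivity)
  rw [Real.coe_toNNReal _ hs2.le, mul_div_cancel_left₀ _ (by positivity), Real.exp_neg,
    Real.exp_log (by positivity), inv_div] at h
  -- The Gaussian tail without prefactor gives β/2, which is more than needed.
  refine (measure_mono fun η hη => ?_).trans (h.trans (ENNReal.ofReal_le_ofReal (by linarith)))
  have h1 : 2 * s ^ 2 * Real.log (2 / β) / n ≤
      |(regressionTask Sig s θstar).minLoss (LearningTask.full (noisyData θstar X η)) -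
        (regressionTask Sig s θstar).minLoss (LearningTask.leaveOut (noisyData θstar X η) i)| := hη
  rw [hfη, div_le_iff₀ hn'] at h1
  refine le_trans h1 (le_of_eq ?_)
  field_simp

variable [NeZero d]

theorem sampleLaw_exists_isEmpMinimizer_le (hSig : Sig.PosDef) (hs : 0 < s) (hn : 0 < n) {τ : ℝ}
    (hτ : 0 ≤ τ) :
    (regressionTask Sig s θstar).sampleLaw n
      {Z | ∃ θ, (regressionTask Sig s θstar).IsEmpMinimizer (LearningTask.full Z) θ ∧
        τ ≤ |θ 0 - θstar 0|} ≤
      ENNReal.ofReal ((Real.sqrt (1 + τ ^ 2 / s ^ 2 * (1 / Sig⁻¹ 0 0)))⁻¹ ^ (n + 1 - d)) := by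
  have hs2 : 0 < s ^ 2 := by positivity
  have hn' : (0 : ℝ) < n := by exact_mod_cast hn
  -- A measurable event containing the given one, whose quantifier over minimizers makes its own
  -- measurability unclear.
  have hmeas : MeasurableSet {Z : Fin n → EuclideanSpace ℝ (Fin d) × ℝ |
      ‖firstResidual fun j => (Z j).1‖ ^ 2 * τ ^ 2 ≤
        n * ((regressionTask Sig s θstar).minLossAt (θstar 0) (LearningTask.full Z) -
          (regressionTask Sig s θstar).minLoss (LearningTask.full Z))} :=
    measurableSet_le ((measurable_norm_firstResidual_sq_comp (by fun_prop)).mul_const _)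
      (((measurable_minLossAt_full Sig s θstar _).sub
        (measurable_minLoss_full Sig s θstar)).const_mul _)
  have hsub : {Z : Fin n → EuclideanSpace ℝ (Fin d) × ℝ |
      ∃ θ, (regressionTask Sig s θstar).IsEmpMinimizer (LearningTask.full Z) θ ∧
      τ ≤ |θ 0 - θstar 0|} ⊆ {Z | ‖firstResidual fun j => (Z j).1‖ ^ 2 * τ ^ 2 ≤
        n * ((regressionTask Sig s θstar).minLossAt (θstar 0) (LearningTask.full Z) -
          (regressionTask Sig s θstar).minLoss (LearningTask.full Z))} := by
    rintro Z ⟨θ, hθ, hle⟩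
    rw [Set.mem_ofPred_eq, hθ.minLossAt_sub_minLoss, covariates_full,
      ← sq_abs (θstar 0 - θ 0), abs_sub_comm]
    have e : (n : ℝ) * (1 / n * ‖firstResidual fun j => (Z j).1‖ ^ 2 * |θ 0 - θstar 0| ^ 2) =
        ‖firstResidual fun j => (Z j).1‖ ^ 2 * |θ 0 - θstar 0| ^ 2 := by field_simp
    rw [e]
    gcongr
  refine (measure_mono hsub).trans ((sampleLaw_regressionTask_le Sig s θstar
    hmeas
    (g := fun X => ENNReal.ofReal (Real.exp (-(τ ^ 2 / (2 * s ^ 2) * ‖firstResidual X‖ ^ 2))))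
    fun X => ?_).trans ?_)
  · obtain ⟨f, hf, hfη⟩ := exists_minLossAt_sub_minLoss_eq_inner_sq Sig s θstar X
    have h := pi_gaussianReal_le_inner_sq_le (s ^ 2).toNNReal hf
      (t := ‖firstResidual X‖ ^ 2 * τ ^ 2) (by positivity)
    rw [Real.coe_toNNReal _ hs2.le] at h
    refine (measure_mono fun η hη => ?_).trans (h.trans (le_of_eq ?_))
    · have h1 : ‖firstResidual X‖ ^ 2 * τ ^ 2 ≤
          n * ((regressionTask Sig s θstar).minLossAt (θstar 0)
              (LearningTask.full (noisyData θstar X η)) -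
            (regressionTask Sig s θstar).minLoss (LearningTask.full (noisyData θstar X η))) := hη
      rw [hfη] at h1
      refine le_trans h1 (le_of_eq ?_)
      field_simp
    · congr 3
      ring
  · refine (lintegral_exp_neg_mul_norm_firstResidual_sq_le hSig (by positivity)).trans
      (le_of_eq ?_)
    congr 5
    field_simp

/-- Chernoff with t = 1/(4μ), for which 1 + 2tμ = 3/2. -/
theorem pi_multivariateGaussian_norm_firstResidual_sq_le_le (hSig : Sig.PosDef) :
    Measure.pi (fun _ : Fin n => multivariateGaussian 0 Sig)
      {X | ‖firstResidual X‖ ^ 2 ≤ n * (1 / Sig⁻¹ 0 0) / 2} ≤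
      ENNReal.ofReal (Real.exp (n / 8 - ((n + 1 - d : ℕ) : ℝ) / 2 * Real.log (3 / 2))) := by
  have hm := inv_diag_pos hSig 0
  have h := lintegral_exp_neg_mul_norm_firstResidual_sq_le (n := n) hSig
    (t := 1 / (4 * (1 / Sig⁻¹ 0 0))) (by positivity)
  generalize 1 / Sig⁻¹ 0 0 = m at hm h ⊢
  have h1 := measure_le_exp_mul_lintegral_exp
    (Measure.pi (fun _ : Fin n => multivariateGaussian 0 Sig)) (u := 1 / (4 * m)) (by positivity)
    (measurable_norm_firstResidual_sq (d := d) (n := n)).neg (-(n * m / 2))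
  have e : 1 + 2 * (1 / (4 * m)) * m = 3 / 2 := by field_simp; norm_num
  rw [e, inv_sqrt_pow_eq_exp (by norm_num)] at h
  simp only [Pi.neg_apply, neg_le_neg_iff, mul_neg, neg_neg] at h1
  refine h1.trans ((mul_le_mul_right h _).trans (le_of_eq ?_))
  rw [← ENNReal.ofReal_mul (by positivity), ← Real.exp_add]
  congr 2
  have : 1 / (4 * m) * (n * m / 2) = n / 8 := by field_simp; ring
  rw [this]
  ring

theorem pi_multivariateGaussian_le_norm_firstResidual_sq_le (hSig : Sig.PosDef) :
    Measure.pi (fun _ : Fin n => multivariateGaussian 0 Sig)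
      {X | 2 * (n * (1 / Sig⁻¹ 0 0)) ≤ ‖firstResidual X‖ ^ 2} ≤
      ENNReal.ofReal (Real.exp (n / 2 * Real.log 2 - n / 2)) := by
  have hm := inv_diag_pos hSig 0
  have h := pi_gaussianReal_mul_le_sum_sq_le (ι := Fin n) (v := Real.toNNReal (1 / Sig⁻¹ 0 0))
    (by simpa using hm) (2 * n)
  rw [← map_residual_pi_multivariateGaussian n hSig 0, Measure.map_apply (by fun_prop)
    (measurableSet_le measurable_const (by fun_prop)), Real.coe_toNNReal _ hm.le,
    Fintype.card_fin] at h
  refine (measure_mono fun X hX => ?_).trans (h.trans (le_of_eq ?_))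
  · have hX : 2 * (n * (1 / Sig⁻¹ 0 0)) ≤ ‖firstResidual X‖ ^ 2 := hX
    rw [← mul_assoc] at hX
    exact hX.trans (norm_firstResidual_sq_le X (residualDirection_self hSig 0))
  · congr 3
    ring

theorem pi_multivariateGaussian_norm_firstResidual_sq_outside_le_of_eq_one (hSig : Sig.PosDef)
    (hd : d = 1) (hn : 0 < n) :
    Measure.pi (fun _ : Fin n => multivariateGaussian 0 Sig)
      {X | ‖firstResidual X‖ ^ 2 ≤ n * (1 / Sig⁻¹ 0 0) / 2 ∨
        2 * (n * (1 / Sig⁻¹ 0 0)) ≤ ‖firstResidual X‖ ^ 2} ≤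
      ENNReal.ofReal ((32 / n + 1) / 9) := by
  have hm := inv_diag_pos hSig 0
  have : Nonempty (Fin n) := ⟨⟨0, hn⟩⟩
  have hq : Measurable fun x : Fin n → ℝ => ∑ i, x i ^ 2 := by fun_prop
  have hS : MeasurableSet {x : Fin n → ℝ | ∑ i, x i ^ 2 ≤ n * (1 / Sig⁻¹ 0 0) / 2 ∨
      2 * (n * (1 / Sig⁻¹ 0 0)) ≤ ∑ i, x i ^ 2} :=
    (measurableSet_le hq measurable_const).union (measurableSet_le measurable_const hq)
  have h := pi_gaussianReal_sum_sq_outside_le (ι := Fin n)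
    (v := Real.toNNReal (1 / Sig⁻¹ 0 0)) (by simpa using hm)
  rw [Real.coe_toNNReal _ hm.le, Fintype.card_fin, ← map_residual_pi_multivariateGaussian n hSig 0,
    Measure.map_apply (by fun_prop) hS] at h
  refine (measure_mono fun X hX => ?_).trans h
  rw [Set.mem_ofPred_eq, norm_firstResidual_sq_of_eq_one hd X
    (c := toLp 2 (residualDirection Sig 0)) (residualDirection_self hSig 0)] at hX
  exact hX

end Regression

/-! ### Numerical constants and the final statement. -/

theorem log_three_halves_gt : (0.39 : ℝ) < Real.log (3 / 2) := by
  have h : Real.log (2 ^ 4) ≤ Real.log ((3 / 2) ^ 7) := Real.log_le_log (by norm_num) (by norm_num)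
  rw [Real.log_pow, Real.log_pow] at h
  have := Real.log_two_gt_d9
  push_cast at h
  linarith

theorem log_three_lt : Real.log 3 < 1.2 := by
  have h : Real.log (3 ^ 5) ≤ Real.log (2 ^ 8) := Real.log_le_log (by norm_num) (by norm_num)
  rw [Real.log_pow, Real.log_pow] at h
  have := Real.log_two_lt_d9
  push_cast at h
  linarith

section Regression

variable {d n : ℕ} {Sig : Matrix (Fin d) (Fin d) ℝ} {s : ℝ} (θstar : EuclideanSpace ℝ (Fin d))
  [NeZero d]

theorem pi_multivariateGaussian_norm_firstResidual_sq_outside_le (hSig : Sig.PosDef) {β : ℝ}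
    (hβ : 0 < β) (hβ1 : β < 1) (hn : 4 * (d : ℝ) + 144 * Real.log (1 / β) ≤ n) :
    Measure.pi (fun _ : Fin n => multivariateGaussian 0 Sig)
      {X | ‖firstResidual X‖ ^ 2 ≤ n * (1 / Sig⁻¹ 0 0) / 2 ∨
        2 * (n * (1 / Sig⁻¹ 0 0)) ≤ ‖firstResidual X‖ ^ 2} ≤ ENNReal.ofReal β := by
  set l := Real.log (1 / β) with hl
  have hl0 : 0 < l := Real.log_pos (by rw [lt_div_iff₀ hβ]; linarith)
  have hβl : β = Real.exp (-l) := by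
    rw [hl, one_div, Real.log_inv, neg_neg, Real.exp_log hβ]
  have hdn : 4 * d + 1 ≤ n := by
    have : (4 * d : ℝ) < n := by linarith
    exact_mod_cast this
  have hd1 : 1 ≤ d := NeZero.one_le
  have hd1' : (1 : ℝ) ≤ d := by exact_mod_cast hd1
  -- The two Chernoff bounds can add up to more than 1 for the smallest n. Here n ≤ 8 forces d = 1
  -- and n ≥ 5, so Chebyshev gives at most 37/45, while 144 l ≤ 4 forces β ≥ 35/36.
  rcases le_or_gt n 8 with h8 | h8
  · refine (pi_multivariateGaussian_norm_firstResidual_sq_outside_le_of_eq_one hSig (by omega)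
      (by omega)).trans (ENNReal.ofReal_le_ofReal ?_)
    have h5 : (5 : ℝ) ≤ n := by exact_mod_cast (show 5 ≤ n by omega)
    have h8' : (n : ℝ) ≤ 8 := by exact_mod_cast h8
    have h32 : 32 / (n : ℝ) ≤ 32 / 5 := by gcongr
    have := Real.add_one_le_exp (-l)
    rw [hβl]
    linarith
  · have h9 : (9 : ℝ) ≤ n := by exact_mod_cast h8
    have hm : (3 * (n : ℝ) + 5) / 4 ≤ ((n + 1 - d : ℕ) : ℝ) := by
      rw [Nat.cast_sub (by omega)]
      have : (4 * d + 1 : ℝ) ≤ n := by exact_mod_cast hdn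
      push_cast
      linarith
    -- The lower tail is the heavier one, so β is split unevenly.
    have h1 : Real.exp (n / 8 - ((n + 1 - d : ℕ) : ℝ) / 2 * Real.log (3 / 2)) ≤ 2 / 3 * β := by
      rw [← Real.le_log_iff_exp_le (by positivity), Real.log_mul (by norm_num) hβ.ne', hβl,
        Real.log_exp, show (2 / 3 : ℝ) = (3 / 2)⁻¹ by norm_num, Real.log_inv]
      have := log_three_halves_gt
      nlinarith
    have h2 : Real.exp (n / 2 * Real.log 2 - n / 2) ≤ 1 / 3 * β := by
      rw [← Real.le_log_iff_exp_le (by positivity), Real.log_mul (by norm_num) hβ.ne', hβl,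
        Real.log_exp, one_div, Real.log_inv]
      have := log_three_lt
      have := Real.log_two_lt_d9
      nlinarith
    refine (measure_union_le _ _).trans ((add_le_add
      ((pi_multivariateGaussian_norm_firstResidual_sq_le_le hSig).trans
        (ENNReal.ofReal_le_ofReal h1))
      ((pi_multivariateGaussian_le_norm_firstResidual_sq_le hSig).trans
        (ENNReal.ofReal_le_ofReal h2))).trans ?_)
    rw [← ENNReal.ofReal_add (by positivity) (by positivity)]
    exact ENNReal.ofReal_le_ofReal (by linarith)

theorem le_sampleLaw_minLossAt_sub_minLoss (hSig : Sig.PosDef) {β : ℝ} (hβ : 0 < β)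
    (hn : 4 * (d : ℝ) + 144 * Real.log (1 / β) ≤ n) :
    ENNReal.ofReal (1 - β) ≤ (regressionTask Sig s θstar).sampleLaw n
      {Z | ∀ θ, (regressionTask Sig s θstar).IsEmpMinimizer (LearningTask.full Z) θ → ∀ w : ℝ,
        1 / Sig⁻¹ 0 0 * (w - θ 0) ^ 2 / 2 ≤
            (regressionTask Sig s θstar).minLossAt w (LearningTask.full Z) -
              (regressionTask Sig s θstar).minLoss (LearningTask.full Z) ∧
          (regressionTask Sig s θstar).minLossAt w (LearningTask.full Z) -
              (regressionTask Sig s θstar).minLoss (LearningTask.full Z) ≤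
            2 * (1 / Sig⁻¹ 0 0) * (w - θ 0) ^ 2} := by
  rcases le_or_gt 1 β with h1 | h1
  · rw [ENNReal.ofReal_of_nonpos (by linarith)]
    exact zero_le
  have hbad := pi_multivariateGaussian_norm_firstResidual_sq_outside_le hSig hβ h1 hn
  have hn' : (0 : ℝ) < n := by
    have : 0 < Real.log (1 / β) := Real.log_pos (by rw [lt_div_iff₀ hβ]; linarith)
    have : (0 : ℝ) ≤ d := by positivity
    linarith
  generalize 1 / Sig⁻¹ 0 0 = m at hbad ⊢
  have hmq := measurable_norm_firstResidual_sq (d := d) (n := n)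
  have hB : MeasurableSet {X : Fin n → EuclideanSpace ℝ (Fin d) |
      ‖firstResidual X‖ ^ 2 ≤ n * m / 2 ∨ 2 * (n * m) ≤ ‖firstResidual X‖ ^ 2} :=
    (measurableSet_le hmq measurable_const).union (measurableSet_le measurable_const hmq)
  have hfst : Measurable fun (Z : Fin n → EuclideanSpace ℝ (Fin d) × ℝ) j => (Z j).1 := by fun_prop
  rw [← map_fst_sampleLaw_regressionTask Sig s θstar, Measure.map_apply hfst hB] at hbad
  have hgood := prob_compl_eq_one_sub (μ := (regressionTask Sig s θstar).sampleLaw n) (hfst hB)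
  rw [ENNReal.ofReal_sub _ hβ.le, ENNReal.ofReal_one]
  refine (tsub_le_tsub_left hbad 1).trans (hgood.ge.trans (measure_mono fun Z hZ θ hθ w => ?_))
  have hZ : ¬ (‖firstResidual fun j => (Z j).1‖ ^ 2 ≤ n * m / 2 ∨
      2 * (n * m) ≤ ‖firstResidual fun j => (Z j).1‖ ^ 2) := hZ
  push Not at hZ
  rw [hθ.minLossAt_sub_minLoss, covariates_full]
  have hlow : m / 2 ≤ 1 / n * ‖firstResidual fun j => (Z j).1‖ ^ 2 := by
    rw [one_div, le_inv_mul_iff₀ hn']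
    linarith [hZ.1]
  have hup : 1 / n * ‖firstResidual fun j => (Z j).1‖ ^ 2 ≤ 2 * m := by
    rw [one_div, inv_mul_le_iff₀ hn']
    linarith [hZ.2]
  constructor
  · rw [mul_div_right_comm]
    gcongr
  · gcongr

theorem sampleLaw_param_concentration_le (hSig : Sig.PosDef) (hs : 0 < s) {α β : ℝ}
    (hα : α ∈ Set.Ioo (0 : ℝ) 1) (hβ : 0 < β)
    (hn : 4 * (d : ℝ) + 144 * max 1 (s ^ 2) * Real.log (1 / β) / α ^ 2 ≤ n) :
    (regressionTask Sig s θstar).sampleLaw n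
      {Z | ∃ θ, (regressionTask Sig s θstar).IsEmpMinimizer (LearningTask.full Z) θ ∧
        α * (1 / Sig⁻¹ 0 0) ^ (-(1 / 2) : ℝ) ≤ |θ 0 - θstar 0|} ≤ ENNReal.ofReal β := by
  rcases le_or_gt 1 β with h1 | h1
  · exact prob_le_one.trans (by simpa using h1)
  obtain ⟨hα0, hα1⟩ := hα
  have hm := inv_diag_pos hSig 0
  set l := Real.log (1 / β) with hl
  have hl0 : 0 < l := Real.log_pos (by rw [lt_div_iff₀ hβ]; linarith)
  have hlβ : Real.log β = -l := by rw [hl, one_div, Real.log_inv, neg_neg]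
  set M := max 1 (s ^ 2)
  have hM1 : 1 ≤ M := le_max_left _ _
  have hMs : s ^ 2 ≤ M := le_max_right _ _
  have hs2 : 0 < s ^ 2 := by positivity
  have hd1 : (1 : ℝ) ≤ d := by exact_mod_cast (NeZero.one_le : 1 ≤ d)
  have hK : 0 < 144 * M * l / α ^ 2 := by positivity
  have hn' : (0 : ℝ) < n := by linarith
  refine (sampleLaw_exists_isEmpMinimizer_le θstar hSig hs (by exact_mod_cast hn')
    (by positivity)).trans (ENNReal.ofReal_le_ofReal ?_)
  generalize 1 / Sig⁻¹ 0 0 = m at hm ⊢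
  have hpow : (m ^ (-(1 / 2) : ℝ)) ^ 2 = m⁻¹ := by
    rw [← Real.rpow_natCast, ← Real.rpow_mul hm.le]
    norm_num [Real.rpow_neg_one]
  have e : 1 + (α * m ^ (-(1 / 2) : ℝ)) ^ 2 / s ^ 2 * m = 1 + α ^ 2 / s ^ 2 := by
    rw [mul_pow, hpow]
    field_simp
  rw [e, inv_sqrt_pow_eq_exp (by positivity), ← Real.le_log_iff_exp_le hβ, hlβ, neg_le_neg_iff]
  -- From log(1 + u) ≥ u/(1 + u), with s² ≤ M and α² < 1 ≤ M; this is where α < 1 and the maximum in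
  -- K enter.
  have hlog : α ^ 2 / (2 * M) ≤ Real.log (1 + α ^ 2 / s ^ 2) := by
    refine le_trans ?_ (Real.one_sub_inv_le_log_of_pos (by positivity))
    have : 1 - (1 + α ^ 2 / s ^ 2)⁻¹ = α ^ 2 / (s ^ 2 + α ^ 2) := by
      field_simp
      ring
    rw [this]
    gcongr
    nlinarith
  have hdn : d ≤ n + 1 := by
    have : (d : ℝ) ≤ n + 1 := by linarith
    exact_mod_cast this
  have hcard : 144 * M * l / α ^ 2 / 2 ≤ ((n + 1 - d : ℕ) : ℝ) := by
    rw [Nat.cast_sub hdn]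
    push_cast
    linarith
  -- The right side equals 18 l, so the constant 144 is generous here.
  calc l ≤ 144 * M * l / α ^ 2 / 2 / 2 * (α ^ 2 / (2 * M)) := by
        field_simp
        norm_num
    _ ≤ _ := by gcongr

end Regression

theorem propositionF2 {d : ℕ} [NeZero d] (Sig : Matrix (Fin d) (Fin d) ℝ) (hSig : Sig.PosDef)
    (s : ℝ) (hs : 0 < s) (θstar : EuclideanSpace ℝ (Fin d)) :
    (regressionTask Sig s θstar).IdentifiableOn (Set.Ioo 0 1)
      (fun _ => 4 * (d : ℝ)) (4 * (d : ℝ)) (144 * max 1 (s ^ 2)) (2 * s ^ 2)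
      (1 / (Sig⁻¹ 0 0)) (2 * s) where
  pos := by
    have hd : (0 : ℝ) < d := by exact_mod_cast (NeZero.pos d)
    have hm := inv_diag_pos hSig 0
    exact ⟨by positivity, by positivity, by positivity, hm, by positivity⟩
  exists_popMinimizer := ⟨θstar, regressionTask_isPopMinimizer_self s θstar hSig.posSemidef⟩
  exists_empMinimizer _ S := exists_isEmpMinimizer_regressionTask Sig s θstar S
  exists_minLossAt n S w := by
    obtain ⟨⟨θ, hθ, hw, h1⟩, h2⟩ := isLeast_empLossAt_regressionTask Sig s θstar w S
    exact ⟨θ, hθ, hw, fun θ' hθ' hw' => h1 ▸ h2 ⟨θ', hθ', hw', rfl⟩⟩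
  param_concentration α hα β hβ n hn θD hθD := by
    rw [regressionTask_isPopMinimizer_iff s θstar hSig] at hθD
    subst hθD
    exact sampleLaw_param_concentration_le _ hSig hs hα hβ hn
  smooth_strongConvex β hβ n hn := by
    -- For β > 1 the logarithm is negative and 144 could not replace the larger K; the claim is then
    -- trivial.
    rcases le_or_gt 1 β with h1 | h1
    · rw [ENNReal.ofReal_of_nonpos (by linarith)]
      exact zero_le
    refine le_sampleLaw_minLossAt_sub_minLoss θstar hSig hβ (le_trans ?_ hn)
    have hl0 : 0 ≤ Real.log (1 / β) := Real.log_nonneg (by rw [le_div_iff₀ hβ]; linarith)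
    have hM : 1 ≤ max 1 (s ^ 2) := le_max_left _ _
    nlinarith
  leave_one_out β hβ _ _ i := sampleLaw_le_abs_minLoss_sub_minLoss_leaveOut_le θstar hs hβ i
  tail_bound β hβ _ hn := sampleLaw_le_minLoss_le θstar hs hβ hn
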